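/- Let $\mathbb D_r=\{z\in\mathbb C:|z|<r\}$, $\mathbb D=\mathbb D_1$, and let $\mathcal A$ be the class of analytic $f:\mathbb D\to\mathbb C$ with $f(0)=0$, $f'(0)=1$. Put $s_f(z)=zf'(z)/f(z)$ (with $s_f(0)=1$). For $0\le\alpha<1$, $\mathcal S^*(\alpha)$ is the class of univalent $f\in\mathcal A$ with $\operatorname{Re}s_f>\alpha$ in $\mathbb D$. For an analytic $\varphi:\mathbb D\to\mathbb C$ with $\varphi(0)=1$, $\mathcal S^*(\varphi)$ is the class of $f\in\mathcal A$ with $f(z)\ne0$ for $z\neq0$ and $s_f\prec\varphi$, that is, $s_f=\varphi\circ\omega$ for some analytic $\omega:\mathbb D\to\mathbb D$ with $\omega(0)=0$. Let $\mathcal S^*_L,\mathcal S^*_e,\mathcal S^*_c,\mathcal S^*_{\sin},\mathcal S^*_{\mathrm{lune}},\mathcal S^*_R,\mathcal S^*_P$ be $\mathcal S^*(\varphi)$ for, respectively, $$\sqrt{1+z},\quad e^z,\quad 1+\tfrac43z+\tfrac23z^2,\quad 1+\sin z,\quad z+\sqrt{1+z^2},\quad 1+\frac{kz+z^2}{k^2-kz}\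 (k=\sqrt2+1),\quad 1+\frac2{\pi^2}\Bigl(\log\frac{1+\sqrt z}{1-\sqrt z}\Bigr)^2 .$$ A function $f$ is said to have the property defining one of these classes in $\mathbb D_r$ if the defining conditions hold with $\mathbb D_r$ in place of $\mathbb D$ as the domain of $f$, $s_f$ and $\omega$ (while $\omega$ still takes values in $\mathbb D$). For $\mathcal F\subset\mathcal A$, the $\mathcal G$-radius $R_{\mathcal G}(\mathcal F)$ is the largest $R\in[0,1]$ such that every $f\in\mathcal F$ has the property defining $\mathcal G$ in $\mathbb D_r$ for each $0<r<R$. Let $$\mathcal F_3=\Bigl\{f\in\mathcal A:\operatorname{Re}\frac{f(z)}{z+z^2/2}>0\text{ in }\mathbb D\Bigr\},\qquad f_3(z)=\frac{(1+z)(z+z^2/2)}{1-z},$$ where the quotient takes its limit value $1$ at $z=0$, and write $R_{\mathcal G}=R_{\mathcal G}(\mathcal F_3)$. **Theorem 3.** The following sharp radius results hold for $\mathcal F_3$. 1. For each $0\le\alpha<1$, $R_{\mathcal S^*(\alpha)}$ is the smallest positive root of $(2-\alpha)r^3+2\alpha r^2+(\alpha-6)r+2-2\alpha=0$. 2. $R_{\mathcal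 S^*_L}\approx0.1645$ is the smallest positive root of $(\sqrt2-2)r^3+2\sqrt2\,r^2+(6-\sqrt2)r+2-2\sqrt2=0$. 3. $R_{\mathcal S^*_P}=R_{\mathcal S^*(1/2)}\approx0.19028$. 4. $R_{\mathcal S^*_e}=R_{\mathcal S^*(1/e)}\approx0.2355$. 5. $R_{\mathcal S^*_{\sin}}=R_{\mathcal S^*(1-\sin1)}\approx0.3017$. 6. $R_{\mathcal S^*_{\mathrm{lune}}}=R_{\mathcal S^*(\sqrt2-1)}\approx0.2199$. 7. $R_{\mathcal S^*_R}=R_{\mathcal S^*(2(\sqrt2-1))}\approx0.0679$. 8. $R_{\mathcal S^*_c}=R_{\mathcal S^*(1/3)}\approx0.2469$. In all cases $f_3$ is extremal: $f_3\in\mathcal F_3$, and $R_{\mathcal G}(\{f_3\})=R_{\mathcal G}(\mathcal F_3)$ for each of the classes $\mathcal G$ above. The decimal values are correct to the number of digits shown (rounded). -/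

import Mathlib

namespace CloseToStar

/-- `f` is normalized analytic on the disk `|z| < r`: `f(0) = 0`, `f'(0) = 1`.
For `r = 1` this is the class `𝒜`; only the values of `f` on the disk matter. -/
def NormalizedOn (r : ℝ) (f : ℂ → ℂ) : Prop :=
  DifferentiableOn ℂ f (Metric.ball 0 r) ∧ f 0 = 0 ∧ deriv f 0 = 1

/-- `s_f(z) = z f'(z) / f(z)`, with the removable singularity at `0` filled in by the
limit `1`. -/
noncomputable def starQuotient (f : ℂ → ℂ) (z : ℂ) : ℂ :=
  if z = 0 then 1 else z * deriv f z / f z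

/-- `f` is starlike of order `α` in the disk `|z| < r`: normalized, univalent there, and
`Re (z f'(z) / f(z)) > α`. For `r = 1` this is the class `𝒮*(α)`. -/
def StarlikeOfOrder (α : ℝ) (r : ℝ) (f : ℂ → ℂ) : Prop :=
  NormalizedOn r f ∧ Set.InjOn f (Metric.ball 0 r) ∧
    ∀ z ∈ Metric.ball (0 : ℂ) r, α < (starQuotient f z).re

/-- `s` is subordinate to `φ` in the disk `|z| < r`: `s = φ ∘ ω` there, with `ω` analytic from
that disk to the unit disk and `ω(0) = 0`. -/
def SubordinateOn (r : ℝ) (s φ : ℂ → ℂ) : Prop :=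
  ∃ ω : ℂ → ℂ, DifferentiableOn ℂ ω (Metric.ball 0 r) ∧
    Set.MapsTo ω (Metric.ball 0 r) (Metric.ball 0 1) ∧ ω 0 = 0 ∧
    ∀ z ∈ Metric.ball (0 : ℂ) r, s z = φ (ω z)

/-- `f` has, in the disk `|z| < r`, the property that defines `𝒮*(φ)`: it is normalized, has no
zero other than `0` (so that `s_f` makes sense), and `s_f ≺ φ`. For `r = 1` this is `𝒮*(φ)`. -/
def StarlikeSubord (φ : ℂ → ℂ) (r : ℝ) (f : ℂ → ℂ) : Prop :=
  NormalizedOn r f ∧ (∀ z ∈ Metric.ball (0 : ℂ) r, z ≠ 0 → f z ≠ 0) ∧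
    SubordinateOn r (starQuotient f) φ

/-- `√(1 + z)` (lemniscate). -/
noncomputable def phiL (z : ℂ) : ℂ := (1 + z) ^ (1 / 2 : ℂ)

/-- `e ^ z` (exponential). -/
noncomputable def phiE (z : ℂ) : ℂ := Complex.exp z

/-- `1 + (4/3) z + (2/3) z²` (cardioid). -/
noncomputable def phiC (z : ℂ) : ℂ := 1 + (4 / 3) * z + (2 / 3) * z ^ 2

/-- `1 + sin z` (sine). -/
noncomputable def phiSin (z : ℂ) : ℂ := 1 + Complex.sin z

/-- `z + √(1 + z²)` (lune). -/
noncomputable def phiLune (z : ℂ) : ℂ := z + (1 + z ^ 2) ^ (1 / 2 : ℂ)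

/-- `1 + (k z + z²) / (k² - k z)` with `k = √2 + 1` (rational function). -/
noncomputable def phiR (z : ℂ) : ℂ :=
  let k : ℂ := ((Real.sqrt 2 + 1 : ℝ) : ℂ)
  1 + (k * z + z ^ 2) / (k ^ 2 - k * z)

/-- `1 + (2 / π²) (log ((1 + √z) / (1 - √z)))²` (parabola); the value does not depend on the
choice of the square root. -/
noncomputable def phiP (z : ℂ) : ℂ :=
  1 + 2 / (Real.pi : ℂ) ^ 2 *
    Complex.log ((1 + z ^ (1 / 2 : ℂ)) / (1 - z ^ (1 / 2 : ℂ))) ^ 2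

/-- The class `ℱ₃` of normalized analytic functions on the unit disk with
`Re (f(z) / (z + z²/2)) > 0`. At `z = 0` the quotient has the removable value `1`, so the
condition is required at the other points only. -/
def F3 : Set (ℂ → ℂ) :=
  {f | NormalizedOn 1 f ∧
    ∀ z ∈ Metric.ball (0 : ℂ) 1, z ≠ 0 → 0 < (f z / (z + z ^ 2 / 2)).re}

/-- The function `(1 + z) (z + z²/2) / (1 - z)`. -/
noncomputable def f3 (z : ℂ) : ℂ := (1 + z) * (z + z ^ 2 / 2) / (1 - z)

/-- `R` is the `P`-radius of the class `F`: the largest number in `[0, 1]` such that every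
function of `F` has the property `P` in each disk `|z| < r` with `0 < r < R`. -/
def IsRadius (P : ℝ → (ℂ → ℂ) → Prop) (F : Set (ℂ → ℂ)) (R : ℝ) : Prop :=
  IsGreatest {ρ : ℝ | 0 ≤ ρ ∧ ρ ≤ 1 ∧ ∀ f ∈ F, ∀ r : ℝ, 0 < r → r < ρ → P r f} R

/-- `R` is the `P`-radius of `F`, and it is sharp for the member `g` of `F`: already the
`P`-radius of `g` alone is `R`. -/
def IsSharpRadius (P : ℝ → (ℂ → ℂ) → Prop) (F : Set (ℂ → ℂ)) (g : ℂ → ℂ) (R : ℝ) : Prop :=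
  IsRadius P F R ∧ g ∈ F ∧ IsRadius P {g} R

end CloseToStar

open CloseToStar

section

open Metric Set Filter Topology
open scoped ComplexConjugate

/-! Every `f` in `F3` is p(z)(z + z²/2) with Re p > 0, so s_f = 1 + z p'/p + z/(2 + z). On |z| = r,
Schwarz–Pick for p bounds z p'/p by 2r/(1 - r²), and z/(2 + z) is at most r/(2 - r) in modulus.
Hence |s_f - 1| ≤ 1 - q(-r), where q = `extremalQuotient` gives the values of s_f for `f3` on the
real axis. Since q is strictly increasing, q(-R) = α determines R: on |z| < R every s_f stays in |w
- 1| < 1 - α, while `f3` reaches α at -R.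

For order α this yields Re s_f > α, and univalence follows from starlikeness
(`injOn_ball_of_starlike`). For six of the functions φ, α = φ(-1): φ has an analytic right inverse g
from |w - 1| < 1 - α into the unit disk, so ω = g ∘ s_f works (`SubordinatesDisk`), and φ omits α on
the open disk, so `f3` fails beyond R (`exists_radius_of_subordinatesDisk`).

For the lemniscate the obstruction is the right vertex √2, reached by `f3` at z = R with q(R) = √2.
The disk about 1 is too crude on that side; the sharp disk with centre slightly left of 1
(`norm_starQuotient_sub_center_le`) is shown to lie inside the lemniscate. -/

/-! ### Schwarz–Pick for positive real part -/

theorem one_add_conj_mul_ne_zero {a z : ℂ} (ha : ‖a‖ < 1) (hz : ‖z‖ < 1) :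
    1 + conj a * z ≠ 0 := by
  intro h
  have h1 : ‖conj a * z‖ = 1 := by
    rw [show conj a * z = -1 by linear_combination h]; simp
  rw [norm_mul, RCLike.norm_conj] at h1
  nlinarith [norm_nonneg a, norm_nonneg z]

/-- Follows from |1 + āz|² - |z + a|² = (1 - |a|²)(1 - |z|²). -/
theorem norm_add_div_one_add_conj_mul_lt_one {a z : ℂ} (ha : ‖a‖ < 1) (hz : ‖z‖ < 1) :
    ‖(z + a) / (1 + conj a * z)‖ < 1 := by
  have h0 := norm_pos_iff.mpr (one_add_conj_mul_ne_zero ha hz)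
  rw [norm_div, div_lt_one h0, ← sq_lt_sq₀ (norm_nonneg _) (norm_nonneg _)]
  have ha' : ‖a‖ ^ 2 < 1 := by nlinarith [norm_nonneg a]
  have hz' : ‖z‖ ^ 2 < 1 := by nlinarith [norm_nonneg z]
  rw [Complex.sq_norm, Complex.normSq_apply] at *
  rw [Complex.sq_norm, Complex.normSq_apply]
  simp
  nlinarith

/-- The squares differ by 4 Re w Re v. -/
theorem norm_sub_lt_norm_add_conj {w v : ℂ} (hw : 0 < w.re) (hv : 0 < v.re) :
    ‖w - v‖ < ‖w + conj v‖ := by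
  rw [← sq_lt_sq₀ (norm_nonneg _) (norm_nonneg _), Complex.sq_norm, Complex.normSq_apply,
    Complex.sq_norm, Complex.normSq_apply]
  simp
  nlinarith

/-- Schwarz–Pick for functions with positive real part on the unit disk. -/
theorem norm_deriv_le_of_re_pos {p : ℂ → ℂ} (hp : DifferentiableOn ℂ p (ball 0 1))
    (hre : ∀ z ∈ ball (0 : ℂ) 1, 0 < (p z).re) {a : ℂ} (ha : a ∈ ball (0 : ℂ) 1) :
    ‖deriv p a‖ * (1 - ‖a‖ ^ 2) ≤ 2 * (p a).re := by
  have ha1 : ‖a‖ < 1 := by simpa using ha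
  set M : ℂ → ℂ := fun z => (z + a) / (1 + conj a * z) with hM
  have hMmaps : MapsTo M (ball 0 1) (ball 0 1) := fun z hz => by
    exact mem_ball_zero_iff.mpr
      (norm_add_div_one_add_conj_mul_lt_one ha1 (mem_ball_zero_iff.mp hz))
  have hMd : DifferentiableOn ℂ M (ball 0 1) := fun z hz => by
    have := one_add_conj_mul_ne_zero ha1 (z := z) (by simpa using hz)
    apply DifferentiableAt.differentiableWithinAt
    fun_prop (disch := assumption)
  have hq := hp.comp hMd hMmaps
  have hre0 := hre a ha
  have hden : ∀ z ∈ ball (0 : ℂ) 1, (p ∘ M) z + conj (p a) ≠ 0 := fun z hz h => by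
    have := norm_sub_lt_norm_add_conj (hre _ (hMmaps hz)) hre0
    simp only [Function.comp] at h
    rw [h, norm_zero] at this
    exact absurd this (norm_nonneg _).not_gt
  -- The automorphism `M` sends 0 to `a`, and a Cayley transform sends p(a) to 0. So `F` is a
  -- self-map of the disk fixing 0, and the claim is |F'(0)| ≤ 1.
  set F : ℂ → ℂ := fun z => ((p ∘ M) z - p a) / ((p ∘ M) z + conj (p a)) with hF
  have hM0 : M 0 = a := by simp [hM]
  have hF0 : F 0 = 0 := by simp [hF, hM0]
  have hFd : DifferentiableOn ℂ F (ball 0 1) :=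
    (hq.sub_const _).div (hq.add_const _) hden
  have hFm : MapsTo F (ball 0 1) (closedBall (F 0) 1) := fun z hz => by
    rw [hF0, mem_closedBall_zero_iff]
    have := norm_sub_lt_norm_add_conj (hre _ (hMmaps hz)) hre0
    simp only [hF, norm_div]
    exact div_le_one_of_le₀ this.le (norm_nonneg _)
  have key := Complex.norm_deriv_le_one_of_mapsTo_ball hFd hFm one_pos
  have hMder : HasDerivAt M (1 - a * conj a) 0 := by
    have h1 : HasDerivAt (fun z : ℂ => z + a) 1 0 := (hasDerivAt_id _).add_const _
    have h2 : HasDerivAt (fun z : ℂ => 1 + conj a * z) (conj a) 0 := by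
      simpa using ((hasDerivAt_id (0 : ℂ)).const_mul (conj a)).const_add 1
    exact (h1.div h2 (by simp)).congr_deriv (by simp)
  have hpa : HasDerivAt p (deriv p a) (M 0) := by
    rw [hM0]; exact (hp.differentiableAt (isOpen_ball.mem_nhds ha)).hasDerivAt
  have hqder := hpa.comp 0 hMder
  have hder := (hqder.sub_const (p a)).div (hqder.add_const (conj (p a)))
    (hden 0 (by simp))
  have hd := hder.deriv
  have hne : p a + conj (p a) ≠ 0 := by simpa [hM0] using hden 0 (by simp)
  have e1 : deriv F 0 = deriv p a * (1 - a * conj a) / (p a + conj (p a)) := by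
    refine hd.trans ?_
    simp only [Function.comp, hM0]
    field_simp
    ring
  have e2 : (1 : ℂ) - a * conj a = ((1 - ‖a‖ ^ 2 : ℝ) : ℂ) := by
    rw [Complex.mul_conj']; push_cast; ring
  have e3 : p a + conj (p a) = ((2 * (p a).re : ℝ) : ℂ) := by
    rw [Complex.add_conj]
  rw [e1, e2, e3, norm_div, norm_mul, Complex.norm_of_nonneg (by nlinarith [norm_nonneg a]),
    Complex.norm_of_nonneg (by positivity), div_le_one (by positivity)] at key
  exact key

/-! ### Analytic inverses on a disk -/

/-- If `h` is injective on the unit disk with `h 0 = 0` and `m ≤ |h|` on the unit circle, then `h`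
has an analytic inverse from the disk of radius `m` to the unit disk. -/
theorem exists_analytic_inverse {h : ℂ → ℂ} {m : ℝ} {U : Set ℂ} (hU : IsOpen U)
    (hsub : closedBall 0 1 ⊆ U) (hdU : DifferentiableOn ℂ h U)
    (h0 : h 0 = 0) (hinj : InjOn h (ball 0 1)) (hder : ∀ z ∈ ball (0 : ℂ) 1, deriv h z ≠ 0)
    (hm : ∀ z : ℂ, ‖z‖ = 1 → m ≤ ‖h z‖) :
    ∃ g : ℂ → ℂ, DifferentiableOn ℂ g (ball 0 m) ∧ MapsTo g (ball 0 m) (ball 0 1) ∧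
      (0 < m → g 0 = 0) ∧ ∀ w ∈ ball (0 : ℂ) m, h (g w) = w := by
  have hstrict : ∀ z ∈ ball (0 : ℂ) 1, HasStrictDerivAt h (deriv h z) z := fun z hz =>
    (hdU.analyticAt (hU.mem_nhds (hsub (ball_subset_closedBall hz)))).hasStrictDerivAt
  have hopen : IsOpen (h '' ball 0 1) := by
    rw [isOpen_iff_mem_nhds]
    rintro _ ⟨z, hz, rfl⟩
    rw [← (hstrict z hz).map_nhds_eq (hder z hz)]
    exact image_mem_map (isOpen_ball.mem_nhds hz)
  have hclosed : IsClosed (h '' closedBall 0 1) :=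
    ((isCompact_closedBall _ _).image_of_continuousOn (hdU.continuousOn.mono hsub)).isClosed
  have hcover : ball (0 : ℂ) m ⊆ h '' ball 0 1 := by
    rcases (ball (0 : ℂ) m).eq_empty_or_nonempty with he | hne
    · rw [he]; exact empty_subset _
    have hm0 : 0 < m := nonempty_ball.mp hne
    -- The bound on the circle keeps boundary values of `h` out of the m-disk, which is therefore
    -- covered by two disjoint open sets: the image of the open disk and the complement of the image
    -- of the closed one. Being connected and containing 0 = h(0), it lies in the first.
    refine IsPreconnected.subset_left_of_subset_union hopen hclosed.isOpen_compl ?_ ?_ ?_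
      (convex_ball (0 : ℂ) m).isPreconnected
    · exact disjoint_compl_right.mono_left (image_mono ball_subset_closedBall)
    · intro w hw
      by_cases hw' : w ∈ h '' closedBall 0 1
      · obtain ⟨z, hz, rfl⟩ := hw'
        refine Or.inl ⟨z, ?_, rfl⟩
        rw [mem_closedBall_zero_iff] at hz
        rw [mem_ball_zero_iff] at hw ⊢
        exact lt_of_le_of_ne hz fun he => (hm z he).not_gt hw
      · exact Or.inr hw'
    · exact ⟨0, by simpa using hm0, 0, by simp, h0⟩
  have hg1 : ∀ w ∈ ball (0 : ℂ) m, Function.invFunOn h (ball 0 1) w ∈ ball (0 : ℂ) 1 :=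
    fun w hw => Function.invFunOn_mem (hcover hw)
  have hg2 : ∀ w ∈ ball (0 : ℂ) m, h (Function.invFunOn h (ball 0 1) w) = w :=
    fun w hw => Function.invFunOn_eq (hcover hw)
  refine ⟨Function.invFunOn h (ball 0 1), fun w hw => ?_, hg1, fun hm0 => ?_, hg2⟩
  · set z := Function.invFunOn h (ball 0 1) w with hz
    have hs := hstrict z (hg1 w hw)
    have hz0 := hder z (hg1 w hw)
    have hwz : h z = w := hg2 w hw
    have hL := hs.to_localInverse hz0
    have hLz : hs.localInverse h _ z hz0 (h z) = z :=
      (hs.eventually_left_inverse hz0).self_of_nhds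
    have hLc : Tendsto (hs.localInverse h _ z hz0) (𝓝 (h z)) (𝓝 z) := by
      have := hL.hasDerivAt.continuousAt.tendsto
      rwa [hLz] at this
    -- By continuity the local inverse lands in the unit disk, where injectivity of `h` identifies
    -- it with the global inverse.
    have hev : Function.invFunOn h (ball 0 1) =ᶠ[𝓝 w] hs.localInverse h _ z hz0 := by
      rw [← hwz]
      filter_upwards [hs.eventually_right_inverse hz0,
        hLc.eventually (isOpen_ball.mem_nhds (hg1 w hw)),
        isOpen_ball.mem_nhds (show h z ∈ ball (0 : ℂ) m by rwa [hwz])] with v h1 h2 h3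
      exact hinj (hg1 v h3) h2 ((hg2 v h3).trans h1.symm)
    have := hL.hasDerivAt
    rw [hwz] at this
    exact (this.congr_of_eventuallyEq hev).differentiableAt.differentiableWithinAt
  · have hmem : (0 : ℂ) ∈ ball (0 : ℂ) m := by simpa using hm0
    exact hinj (hg1 0 hmem) (by simp) ((hg2 0 hmem).trans h0.symm)

/-! ### Starlike functions are univalent -/

theorem eventually_lt_nhdsGT_of_hasDerivAt_neg {u : ℝ → ℝ} {u' x : ℝ} (h : HasDerivAt u u' x)
    (hu : u' < 0) : ∀ᶠ t in 𝓝[>] x, u t < u x := by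
  have h1 := (hasDerivAt_iff_tendsto_slope.mp h).eventually_lt_const hu
  have h2 : ∀ᶠ t in 𝓝[>] x, slope u x t < 0 := h1.filter_mono (nhdsGT_le_nhdsNE x)
  filter_upwards [h2, self_mem_nhdsWithin] with t ht htx
  rw [slope_def_field, div_neg_iff] at ht
  have : 0 < t - x := sub_pos.mpr htx
  rcases ht with ht | ht <;> linarith [ht.1, ht.2]

/-- Where `Re (z f' / f) > 0`, the preimage of the segment from `f a` towards `0` moves
towards the origin. -/
theorem exists_inward_path {f : ℂ → ℂ} {a f' : ℂ} (hf : HasStrictDerivAt f f' a)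
    (hre : 0 < (a * f' / f a).re) :
    ∃ γ : ℝ → ℂ, Tendsto γ (𝓝[>] 0) (𝓝 a) ∧
      ∀ᶠ t in 𝓝[>] (0 : ℝ), ‖γ t‖ < ‖a‖ ∧ f (γ t) = (1 - t) * f a := by
  have ha : a ≠ 0 := by rintro rfl; simp at hre
  have hf' : f' ≠ 0 := by rintro rfl; simp at hre
  have hfa : f a ≠ 0 := by intro h; simp [h] at hre
  set L := hf.localInverse f f' a hf' with hLdef
  have hL := (hf.to_localInverse hf').hasDerivAt
  have hLa : L (f a) = a := (hf.eventually_left_inverse hf').self_of_nhds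
  have hseg : HasDerivAt (fun t : ℝ => (1 - (t : ℂ)) * f a) (-1 * f a) 0 :=
    ((Complex.ofRealCLM.hasDerivAt (x := (0 : ℝ))).const_sub 1).mul_const (f a)
  have hseg0 : (1 - ((0 : ℝ) : ℂ)) * f a = f a := by simp
  have hγ : HasDerivAt (fun t : ℝ => L ((1 - (t : ℂ)) * f a)) (f'⁻¹ * (-1 * f a)) 0 := by
    have hL' : HasDerivAt L f'⁻¹ ((1 - ((0 : ℝ) : ℂ)) * f a) := by rw [hseg0]; exact hL
    exact hL'.comp (0 : ℝ) hseg
  have htend : Tendsto (fun t : ℝ => L ((1 - (t : ℂ)) * f a)) (𝓝[>] 0) (𝓝 a) := by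
    have := hγ.continuousAt.tendsto
    rw [hseg0, hLa] at this
    exact this.mono_left nhdsWithin_le_nhds
  refine ⟨_, htend, ?_⟩
  have hn := hγ.norm_sq
  rw [hseg0, hLa] at hn
  -- The path has velocity -a (a f'/f(a))⁻¹ at t = 0, so |γ|² has derivative -2|a|² Re((a
  -- f'/f(a))⁻¹) there.
  have hneg : 2 * inner ℝ a (f'⁻¹ * (-1 * f a)) < 0 := by
    have e : f'⁻¹ * (-1 * f a) = -(a * (a * f' / f a)⁻¹) := by field_simp
    have hpos : 0 < ((a * f' / f a)⁻¹).re := by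
      rw [Complex.inv_re]
      exact div_pos hre (Complex.normSq_pos.mpr fun h => by simp [h] at hre)
    rw [e, inner_neg_right, Complex.inner]
    have : conj a * (a * (a * f' / f a)⁻¹) = ((‖a‖ ^ 2 : ℝ) : ℂ) * (a * f' / f a)⁻¹ := by
      rw [← mul_assoc, Complex.conj_mul']; push_cast; ring
    rw [mul_comm, mul_comm _ (conj a), this, Complex.re_ofReal_mul]
    have := norm_pos_iff.mpr ha
    have : 0 < ‖a‖ ^ 2 * ((a * f' / f a)⁻¹).re := by positivity
    linarith
  have hev := eventually_lt_nhdsGT_of_hasDerivAt_neg hn hneg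
  have hseg1 : Tendsto (fun t : ℝ => (1 - (t : ℂ)) * f a) (𝓝[>] 0) (𝓝 (f a)) := by
    have := hseg.continuousAt.tendsto
    rw [hseg0] at this
    exact this.mono_left nhdsWithin_le_nhds
  filter_upwards [hev, hseg1.eventually (hf.eventually_right_inverse hf')] with t h1 h2
  refine ⟨?_, h2⟩
  simp only [hseg0, hLa] at h1
  exact lt_of_pow_lt_pow_left₀ 2 (norm_nonneg _) h1

/-- A starlike function is univalent. -/
theorem injOn_ball_of_starlike {f : ℂ → ℂ} {r : ℝ} (hd : DifferentiableOn ℂ f (ball 0 r))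
    (h0 : f 0 = 0) (hd0 : deriv f 0 ≠ 0)
    (hre : ∀ z ∈ ball (0 : ℂ) r, z ≠ 0 → 0 < (z * deriv f z / f z).re) :
    InjOn f (ball 0 r) := by
  have hstrict : ∀ z ∈ ball (0 : ℂ) r, HasStrictDerivAt f (deriv f z) z := fun z hz =>
    (hd.analyticAt (isOpen_ball.mem_nhds hz)).hasStrictDerivAt
  have hderiv : ∀ z ∈ ball (0 : ℂ) r, deriv f z ≠ 0 := fun z hz h => by
    rcases eq_or_ne z 0 with rfl | hz0
    · exact hd0 h
    · simpa [h] using hre z hz hz0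
  have hzero : ∀ z ∈ ball (0 : ℂ) r, f z = 0 → z = 0 := fun z hz h => by
    by_contra hz0
    simpa [h] using hre z hz hz0
  have hcont : ∀ z ∈ ball (0 : ℂ) r, ContinuousAt f z := fun z hz =>
    (hstrict z hz).hasDerivAt.continuousAt
  intro x hx y hy hxy
  by_contra hne
  set ρ := max ‖x‖ ‖y‖ with hρ
  have hρr : ρ < r := max_lt (mem_ball_zero_iff.mp hx) (mem_ball_zero_iff.mp hy)
  have hsub : closedBall (0 : ℂ) ρ ⊆ ball 0 r := closedBall_subset_ball hρr
  -- A collision pair with least maximal modulus exists by compactness. Moving both points along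
  -- preimages of the same segment towards 0 keeps them a collision pair and shrinks both moduli, a
  -- contradiction.
  set K : Set (ℂ × ℂ) := {q | q ∈ closedBall (0 : ℂ) ρ ×ˢ closedBall (0 : ℂ) ρ ∧
    f q.1 = f q.2 ∧ q.1 ≠ q.2} with hK
  have hCcomp : IsCompact (closedBall (0 : ℂ) ρ ×ˢ closedBall (0 : ℂ) ρ) :=
    (isCompact_closedBall _ _).prod (isCompact_closedBall _ _)
  have hKclosed : IsClosed K := by
    refine isClosed_of_closure_subset fun q hq => ?_
    have hqC : q ∈ closedBall (0 : ℂ) ρ ×ˢ closedBall (0 : ℂ) ρ :=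
      closure_minimal (fun q hq => hq.1) hCcomp.isClosed hq
    have h1 := hsub hqC.1
    have h2 := hsub hqC.2
    rw [mem_closure_iff_frequently] at hq
    have t1 : Tendsto (fun p : ℂ × ℂ => f p.1) (𝓝 q) (𝓝 (f q.1)) :=
      (hcont _ h1).tendsto.comp continuousAt_fst.tendsto
    have t2 : Tendsto (fun p : ℂ × ℂ => f p.2) (𝓝 q) (𝓝 (f q.2)) :=
      (hcont _ h2).tendsto.comp continuousAt_snd.tendsto
    refine ⟨hqC, ?_, ?_⟩
    · by_contra hf
      obtain ⟨p, hp, hp'⟩ := (hq.and_eventually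
        ((t1.prodMk_nhds t2).eventually (isOpen_ne_fun continuous_fst continuous_snd |>.mem_nhds hf))).exists
      exact hp' hp.2.1
    -- Collision pairs cannot accumulate on the diagonal, since f' ≠ 0 makes f locally injective.
    · intro he
      have hL := (hstrict _ h1).eventually_left_inverse (hderiv _ h1)
      have e1 := (continuousAt_fst (p := q)).tendsto.eventually hL
      have hsnd : Tendsto Prod.snd (𝓝 q) (𝓝 q.1) := he ▸ (continuousAt_snd (p := q)).tendsto
      have e2 := hsnd.eventually hL
      obtain ⟨p, hp, hp1, hp2⟩ := (hq.and_eventually (e1.and e2)).exists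
      refine hp.2.2 ?_
      rw [← hp1, hp.2.1, hp2]
  have hKcomp : IsCompact K := hCcomp.of_isClosed_subset hKclosed fun q hq => hq.1
  have hKne : K.Nonempty := ⟨(x, y), by simp [hρ], hxy, hne⟩
  obtain ⟨q, hq, hmin⟩ := hKcomp.exists_isMinOn hKne
    (f := fun q : ℂ × ℂ => max ‖q.1‖ ‖q.2‖) (by fun_prop)
  obtain ⟨⟨hq1, hq2⟩, hfq, hqne⟩ := hq
  have hq10 : q.1 ≠ 0 := fun h => hqne (h.trans (hzero _ (hsub hq2) (by rw [← hfq, h, h0])).symm)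
  have hq20 : q.2 ≠ 0 := fun h => hqne ((hzero _ (hsub hq1) (by rw [hfq, h, h0])).trans h.symm)
  obtain ⟨γ₁, hγ₁, hev₁⟩ := exists_inward_path (hstrict _ (hsub hq1)) (hre _ (hsub hq1) hq10)
  obtain ⟨γ₂, hγ₂, hev₂⟩ := exists_inward_path (hstrict _ (hsub hq2)) (hre _ (hsub hq2) hq20)
  obtain ⟨t, ⟨hn1, hf1⟩, ⟨hn2, hf2⟩, hne'⟩ :=
    (hev₁.and (hev₂.and ((hγ₁.prodMk_nhds hγ₂).eventually
      (isOpen_ne_fun continuous_fst continuous_snd |>.mem_nhds hqne)))).exists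
  rw [mem_closedBall_zero_iff] at hq1 hq2
  have hmem : (γ₁ t, γ₂ t) ∈ K :=
    ⟨⟨by simpa using hn1.le.trans hq1, by simpa using hn2.le.trans hq2⟩,
      by simp only [hf1, hf2, hfq], hne'⟩
  exact (max_lt_max hn1 hn2).not_ge (hmin hmem)

/-! ### The quotient z f'/f on the class and its extremal values -/

/-- The value at the real point `x` of `z f' / f` for the extremal function. -/
noncomputable def extremalQuotient (x : ℝ) : ℝ := 1 + 2 * x / (1 - x ^ 2) + x / (2 + x)

theorem extremalQuotient_strictMonoOn : StrictMonoOn extremalQuotient (Ioo (-1) 1) := by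
  rintro x ⟨hx1, hx2⟩ y ⟨hy1, hy2⟩ hxy
  have hx : 0 < 1 - x ^ 2 := by nlinarith
  have hy : 0 < 1 - y ^ 2 := by nlinarith
  have h1 : 2 * x / (1 - x ^ 2) < 2 * y / (1 - y ^ 2) := by
    rw [div_lt_div_iff₀ hx hy]
    have : 0 < 1 + x * y := by nlinarith
    nlinarith [mul_pos (sub_pos.mpr hxy) this]
  have h2 : x / (2 + x) < y / (2 + y) := by
    rw [div_lt_div_iff₀ (by linarith) (by linarith)]; nlinarith
  simp only [extremalQuotient]; linarith

theorem extremalQuotient_continuousOn : ContinuousOn extremalQuotient (Ioo (-1) 1) := by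
  rintro x ⟨hx1, hx2⟩
  have hx : 1 - x ^ 2 ≠ 0 := by nlinarith
  have hx' : 2 + x ≠ 0 := by linarith
  apply ContinuousAt.continuousWithinAt
  unfold extremalQuotient
  fun_prop (disch := assumption)

theorem extremalQuotient_zero : extremalQuotient 0 = 1 := by simp [extremalQuotient]

theorem two_add_ne_zero_of_norm_lt {z : ℂ} (hz : ‖z‖ < 1) : 2 + z ≠ 0 := fun h => by
  have : ‖z‖ = 2 := by rw [show z = -2 by linear_combination h]; simp
  linarith

/-- Functions in `ℱ₃` factor through a function with positive real part. -/
theorem exists_caratheodory_factor {f : ℂ → ℂ} (hf : f ∈ F3) :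
    ∃ p : ℂ → ℂ, DifferentiableOn ℂ p (ball 0 1) ∧ (∀ z ∈ ball (0 : ℂ) 1, 0 < (p z).re) ∧
      ∀ z, ‖z‖ < 1 → f z = p z * (z + z ^ 2 / 2) := by
  obtain ⟨⟨hd, h0, hd0⟩, hre⟩ := hf
  have hfac : ∀ z, f z = dslope f 0 z / (1 + z / 2) * (z + z ^ 2 / 2) ∨ 2 + z = 0 := by
    intro z
    by_cases h2 : 2 + z = 0
    · exact Or.inr h2
    · left
      have h2' : 1 + z / 2 ≠ 0 := fun h => h2 (by linear_combination 2 * h)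
      have := sub_smul_dslope f 0 z
      simp only [sub_zero, h0, smul_eq_mul] at this
      rw [← this]; field_simp
  -- `dslope` fills in f(z)/z at 0 with f'(0) = 1, which makes the factor analytic there.
  refine ⟨fun z => dslope f 0 z / (1 + z / 2), ?_, ?_, ?_⟩
  · refine ((Complex.differentiableOn_dslope (ball_mem_nhds _ one_pos)).mpr hd).div
      (by fun_prop) fun z hz h => ?_
    exact two_add_ne_zero_of_norm_lt (z := z) (by simpa using hz) (by linear_combination 2 * h)
  · intro z hz
    have hz1 : ‖z‖ < 1 := by simpa using hz
    have h2 := two_add_ne_zero_of_norm_lt hz1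
    rcases eq_or_ne z 0 with rfl | hz0
    · simp [hd0]
    · have hne : z + z ^ 2 / 2 ≠ 0 := by
        rw [show z + z ^ 2 / 2 = z * (2 + z) / 2 by ring]
        exact div_ne_zero (mul_ne_zero hz0 h2) two_ne_zero
      have := hre z hz hz0
      rwa [(hfac z).resolve_right h2, mul_div_assoc, div_self hne, mul_one] at this
  · exact fun z hz => (hfac z).resolve_right (two_add_ne_zero_of_norm_lt hz)

theorem starQuotient_eq_of_factor {f p : ℂ → ℂ} (hp : DifferentiableOn ℂ p (ball 0 1))
    (hre : ∀ z ∈ ball (0 : ℂ) 1, 0 < (p z).re)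
    (hfp : ∀ z, ‖z‖ < 1 → f z = p z * (z + z ^ 2 / 2)) {z : ℂ} (hz : ‖z‖ < 1) :
    starQuotient f z = 1 + z * deriv p z / p z + z / (2 + z) := by
  rcases eq_or_ne z 0 with rfl | hz0
  · simp [starQuotient]
  have hzb : z ∈ ball (0 : ℂ) 1 := by simpa using hz
  have hpz : p z ≠ 0 := fun h => by simpa [h] using hre z hzb
  have h2 := two_add_ne_zero_of_norm_lt hz
  have hev : f =ᶠ[𝓝 z] fun z => p z * (z + z ^ 2 / 2) := by
    filter_upwards [isOpen_ball.mem_nhds hzb] with w hw using hfp w (by simpa using hw)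
  have hder : deriv f z = deriv p z * (z + z ^ 2 / 2) + p z * (1 + z) := by
    rw [hev.deriv_eq]
    have h1 := (hp.differentiableAt (isOpen_ball.mem_nhds hzb)).hasDerivAt
    have h3 : HasDerivAt (fun z : ℂ => z + z ^ 2 / 2) (1 + z) z :=
      ((hasDerivAt_id z).add ((hasDerivAt_pow 2 z).div_const 2)).congr_deriv (by simp)
    exact (h1.mul h3).deriv
  rw [starQuotient, if_neg hz0, hder, hfp z hz]
  have hne : z + z ^ 2 / 2 ≠ 0 := by
    rw [show z + z ^ 2 / 2 = z * (2 + z) / 2 by ring]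
    exact div_ne_zero (mul_ne_zero hz0 h2) two_ne_zero
  rw [show z + z ^ 2 / 2 = z * (2 + z) / 2 by ring] at *
  field_simp
  ring

theorem norm_logDeriv_le {p : ℂ → ℂ} (hp : DifferentiableOn ℂ p (ball 0 1))
    (hre : ∀ z ∈ ball (0 : ℂ) 1, 0 < (p z).re) {z : ℂ} (hz : ‖z‖ < 1) :
    ‖z * deriv p z / p z‖ ≤ 2 * ‖z‖ / (1 - ‖z‖ ^ 2) := by
  have hzb : z ∈ ball (0 : ℂ) 1 := by simpa using hz
  have h1 := norm_deriv_le_of_re_pos hp hre hzb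
  have h2 := Complex.re_le_norm (p z)
  have h3 := hre z hzb
  have h4 : 0 < 1 - ‖z‖ ^ 2 := by nlinarith [norm_nonneg z]
  rw [norm_div, norm_mul, div_le_div_iff₀ (by linarith) h4]
  nlinarith [norm_nonneg z]

/-- In fact an equality: z ↦ z/(2 + z) maps |z| = r to the circle with centre -r²/(4 - r²) and
radius 2r/(4 - r²). Unlike the bound centred at 0, this is sharp at z = r. -/
theorem norm_div_two_add_sub_le {z : ℂ} (hz : ‖z‖ < 1) :
    ‖z / (2 + z) + ((‖z‖ ^ 2 / (4 - ‖z‖ ^ 2) : ℝ) : ℂ)‖ ≤ 2 * ‖z‖ / (4 - ‖z‖ ^ 2) := by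
  have h2 := two_add_ne_zero_of_norm_lt hz
  have h4 : 0 < 4 - ‖z‖ ^ 2 := by nlinarith [norm_nonneg z]
  have h4' : ((4 - ‖z‖ ^ 2 : ℝ) : ℂ) ≠ 0 := by exact_mod_cast h4.ne'
  have hcc : ((‖z‖ ^ 2 : ℝ) : ℂ) = z * conj z := by rw [Complex.mul_conj']; push_cast; rfl
  have e : z / (2 + z) + ((‖z‖ ^ 2 / (4 - ‖z‖ ^ 2) : ℝ) : ℂ) =
      2 * z * conj (2 + z) / ((2 + z) * ((4 - ‖z‖ ^ 2 : ℝ) : ℂ)) := by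
    rw [Complex.ofReal_div, div_add_div _ _ h2 h4', Complex.ofReal_sub, hcc]
    congr 1
    simp only [map_add, Complex.conj_ofNat, Complex.ofReal_ofNat]
    ring
  rw [e, norm_div, norm_mul, norm_mul, norm_mul, RCLike.norm_conj, Complex.norm_of_nonneg h4.le]
  have := norm_pos_iff.mpr h2
  apply le_of_eq
  rw [Complex.norm_ofNat]
  field_simp

theorem norm_div_two_add_le {z : ℂ} (hz : ‖z‖ < 1) : ‖z / (2 + z)‖ ≤ ‖z‖ / (2 - ‖z‖) := by
  have h : 2 - ‖z‖ ≤ ‖2 + z‖ := by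
    have := norm_sub_norm_le (2 : ℂ) (-z)
    simpa using this
  rw [norm_div]
  exact div_le_div_of_nonneg_left (norm_nonneg _) (by linarith) h

/-- Both terms of the estimate are extremal for `f3` at -|z|; this controls the left side of the
range. -/
theorem norm_starQuotient_sub_one_le {f : ℂ → ℂ} (hf : f ∈ F3) {z : ℂ} (hz : ‖z‖ < 1) :
    ‖starQuotient f z - 1‖ ≤ 1 - extremalQuotient (-‖z‖) := by
  obtain ⟨p, hp, hre, hfp⟩ := exists_caratheodory_factor hf
  have e : starQuotient f z - 1 = z * deriv p z / p z + z / (2 + z) := by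
    rw [starQuotient_eq_of_factor hp hre hfp hz]; ring
  have e2 : 1 - extremalQuotient (-‖z‖) = 2 * ‖z‖ / (1 - ‖z‖ ^ 2) + ‖z‖ / (2 - ‖z‖) := by
    simp only [extremalQuotient]; ring
  rw [e, e2]
  exact (norm_add_le _ _).trans (add_le_add (norm_logDeriv_le hp hre hz) (norm_div_two_add_le hz))

/-- The rightmost point of this disk is the value of `extremalQuotient` at |z|, attained by `f3`;
needed only for the lemniscate. -/
theorem norm_starQuotient_sub_center_le {f : ℂ → ℂ} (hf : f ∈ F3) {z : ℂ} (hz : ‖z‖ < 1) :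
    ‖starQuotient f z - ((1 - ‖z‖ ^ 2 / (4 - ‖z‖ ^ 2) : ℝ) : ℂ)‖ ≤
      extremalQuotient ‖z‖ - (1 - ‖z‖ ^ 2 / (4 - ‖z‖ ^ 2)) := by
  obtain ⟨p, hp, hre, hfp⟩ := exists_caratheodory_factor hf
  have e : starQuotient f z - ((1 - ‖z‖ ^ 2 / (4 - ‖z‖ ^ 2) : ℝ) : ℂ) = z * deriv p z / p z +
      (z / (2 + z) + ((‖z‖ ^ 2 / (4 - ‖z‖ ^ 2) : ℝ) : ℂ)) := by
    rw [starQuotient_eq_of_factor hp hre hfp hz, Complex.ofReal_sub, Complex.ofReal_one]; ring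
  have e2 : extremalQuotient ‖z‖ - (1 - ‖z‖ ^ 2 / (4 - ‖z‖ ^ 2)) =
      2 * ‖z‖ / (1 - ‖z‖ ^ 2) + 2 * ‖z‖ / (4 - ‖z‖ ^ 2) := by
    have h2 : 0 < 2 - ‖z‖ := by linarith
    have h4 : 0 < 2 + ‖z‖ := by linarith [norm_nonneg z]
    simp only [extremalQuotient]
    rw [show 4 - ‖z‖ ^ 2 = (2 - ‖z‖) * (2 + ‖z‖) by ring]
    field_simp
    ring
  rw [e, e2]
  exact (norm_add_le _ _).trans
    (add_le_add (norm_logDeriv_le hp hre hz) (norm_div_two_add_sub_le hz))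

theorem differentiableOn_starQuotient {f : ℂ → ℂ} (hf : f ∈ F3) :
    DifferentiableOn ℂ (starQuotient f) (ball 0 1) := by
  obtain ⟨p, hp, hre, hfp⟩ := exists_caratheodory_factor hf
  have hp' : DifferentiableOn ℂ (deriv p) (ball 0 1) := hp.deriv isOpen_ball
  have hp0 : ∀ z ∈ ball (0 : ℂ) 1, p z ≠ 0 := fun z hz h => by simpa [h] using hre z hz
  have h2 : ∀ z ∈ ball (0 : ℂ) 1, 2 + z ≠ 0 := fun z hz =>
    two_add_ne_zero_of_norm_lt (by simpa using hz)
  refine DifferentiableOn.congr (f := fun z => 1 + z * deriv p z / p z + z / (2 + z)) ?_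
    fun z hz => starQuotient_eq_of_factor hp hre hfp (by simpa using hz)
  exact ((((differentiableOn_id (𝕜 := ℂ)).mul hp').div hp hp0).const_add 1).add
    ((differentiableOn_id (𝕜 := ℂ)).div (by fun_prop) h2)

theorem ne_zero_of_mem_F3 {f : ℂ → ℂ} (hf : f ∈ F3) {z : ℂ} (hz : ‖z‖ < 1) (hz0 : z ≠ 0) :
    f z ≠ 0 := fun h => by
  simpa [h] using hf.2 z (by simpa using hz) hz0

theorem one_sub_ne_zero_of_norm_lt {z : ℂ} (hz : ‖z‖ < 1) : 1 - z ≠ 0 := fun h => by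
  rw [← sub_eq_zero.mp h] at hz; simp at hz

theorem cayley_re_pos {z : ℂ} (hz : ‖z‖ < 1) : 0 < ((1 + z) / (1 - z)).re := by
  rw [Complex.div_re, ← add_div]
  refine div_pos ?_ (Complex.normSq_pos.mpr (one_sub_ne_zero_of_norm_lt hz))
  have h3 : ‖z‖ ^ 2 < 1 := by nlinarith [norm_nonneg z]
  rw [Complex.sq_norm, Complex.normSq_apply] at h3
  simp
  nlinarith

theorem f3_mem_F3 : f3 ∈ F3 := by
  refine ⟨⟨fun z hz => ?_, by simp [f3], ?_⟩, fun z hz hz0 => ?_⟩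
  · have := one_sub_ne_zero_of_norm_lt (z := z) (by simpa using hz)
    apply DifferentiableAt.differentiableWithinAt
    unfold f3
    fun_prop (disch := assumption)
  · have h1 : HasDerivAt (fun z : ℂ => (1 + z) * (z + z ^ 2 / 2)) 1 0 :=
      (((hasDerivAt_id (0 : ℂ)).const_add 1).mul
        ((hasDerivAt_id (0 : ℂ)).add ((hasDerivAt_pow 2 (0 : ℂ)).div_const 2))).congr_deriv
        (by simp)
    have h2 : HasDerivAt (fun z : ℂ => 1 - z) (-1) 0 := (hasDerivAt_id (0 : ℂ)).const_sub 1
    exact ((h1.div h2 (by simp)).congr_deriv (by simp)).deriv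
  · have hz1 : ‖z‖ < 1 := by simpa using hz
    have h1 := one_sub_ne_zero_of_norm_lt hz1
    have hne : z + z ^ 2 / 2 ≠ 0 := by
      rw [show z + z ^ 2 / 2 = z * (2 + z) / 2 by ring]
      exact div_ne_zero (mul_ne_zero hz0 (two_add_ne_zero_of_norm_lt hz1)) two_ne_zero
    have e : f3 z / (z + z ^ 2 / 2) = (1 + z) / (1 - z) := by
      rw [f3, div_div, mul_comm (1 - z), ← div_div, mul_div_assoc, div_self hne, mul_one]
    rw [e]
    exact cayley_re_pos hz1

/-- Here p is the Cayley function (1 + z)/(1 - z), for which z p'/p = 2z/(1 - z²). -/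
theorem starQuotient_f3 {x : ℝ} (h1 : -1 < x) (h2 : x < 1) :
    starQuotient f3 x = extremalQuotient x := by
  have hx : ‖(x : ℂ)‖ < 1 := by rw [Complex.norm_real]; exact abs_lt.mpr ⟨h1, h2⟩
  have hne : (1 : ℂ) - x ≠ 0 := one_sub_ne_zero_of_norm_lt hx
  have hne' : (1 : ℂ) + x ≠ 0 := by exact_mod_cast (by linarith : (1 : ℝ) + x ≠ 0)
  have hp : DifferentiableOn ℂ (fun z : ℂ => (1 + z) / (1 - z)) (ball 0 1) := fun z hz => by
    have := one_sub_ne_zero_of_norm_lt (z := z) (by simpa using hz)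
    apply DifferentiableAt.differentiableWithinAt
    fun_prop (disch := assumption)
  have hre : ∀ z ∈ ball (0 : ℂ) 1, 0 < ((1 + z) / (1 - z)).re := fun z hz =>
    cayley_re_pos (by simpa using hz)
  have hder : deriv (fun z : ℂ => (1 + z) / (1 - z)) x = 2 / (1 - x) ^ 2 := by
    have h1 : HasDerivAt (fun z : ℂ => 1 + z) 1 (x : ℂ) := (hasDerivAt_id _).const_add 1
    have h2 : HasDerivAt (fun z : ℂ => 1 - z) (-1) (x : ℂ) := (hasDerivAt_id _).const_sub 1
    exact ((h1.div h2 hne).congr_deriv (by ring)).deriv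
  rw [starQuotient_eq_of_factor hp hre (fun z _ => by simp only [f3]; ring) hx, hder]
  simp only [extremalQuotient]
  push_cast
  rw [show (1 : ℂ) - x ^ 2 = (1 - x) * (1 + x) by ring]
  field_simp

/-! ### Sharp radii and starlikeness of order α -/

/-- Failure of the single function `g` beyond R caps the radius of `F` and of {g} alike; the
midpoint of R and a larger candidate ρ is the test radius. -/
theorem isSharpRadius_of_forall {P : ℝ → (ℂ → ℂ) → Prop} {F : Set (ℂ → ℂ)} {g : ℂ → ℂ} {R : ℝ}
    (hR0 : 0 < R) (hR1 : R < 1) (hg : g ∈ F) (hpos : ∀ f ∈ F, ∀ r, 0 < r → r < R → P r f)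
    (hneg : ∀ r, R < r → r < 1 → ¬ P r g) : IsSharpRadius P F g R := by
  have key : ∀ ρ : ℝ, ρ ≤ 1 → (∀ r, 0 < r → r < ρ → P r g) → ρ ≤ R := fun ρ hρ h => by
    by_contra hlt
    push Not at hlt
    exact hneg ((R + ρ) / 2) (by linarith) (by linarith) (h _ (by linarith) (by linarith))
  refine ⟨⟨⟨hR0.le, hR1.le, hpos⟩, fun ρ hρ => key ρ hρ.2.1 (hρ.2.2 g hg)⟩, hg,
    ⟨⟨hR0.le, hR1.le, ?_⟩, fun ρ hρ => key ρ hρ.2.1 (hρ.2.2 g rfl)⟩⟩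
  rintro f rfl
  exact hpos f hg

theorem exists_extremalQuotient_neg_eq {α : ℝ} (h0 : 0 ≤ α) (h1 : α < 1) :
    ∃ R : ℝ, 0 < R ∧ R < 1 ∧ extremalQuotient (-R) = α := by
  -- At -7/20 the extremal quotient is already negative, so one interval serves every α in [0, 1).
  have hc : ContinuousOn extremalQuotient (Icc (-(7 / 20)) 0) :=
    extremalQuotient_continuousOn.mono fun x hx => ⟨by linarith [hx.1], by linarith [hx.2]⟩
  have hlow : extremalQuotient (-(7 / 20)) ≤ α := by
    refine le_trans ?_ h0; norm_num [extremalQuotient]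
  obtain ⟨x, ⟨hx1, hx2⟩, hx⟩ := intermediate_value_Icc (by norm_num) hc
    ⟨hlow, by rw [extremalQuotient_zero]; exact h1.le⟩
  refine ⟨-x, ?_, by linarith, by rwa [neg_neg]⟩
  rcases hx2.lt_or_eq with h | h
  · linarith
  · rw [h, extremalQuotient_zero] at hx; linarith

theorem norm_starQuotient_sub_one_lt {f : ℂ → ℂ} (hf : f ∈ F3) {R : ℝ} (hR1 : R < 1)
    {z : ℂ} (hz : ‖z‖ < R) : ‖starQuotient f z - 1‖ < 1 - extremalQuotient (-R) := by
  refine (norm_starQuotient_sub_one_le hf (hz.trans hR1)).trans_lt ?_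
  have hn := norm_nonneg z
  have := extremalQuotient_strictMonoOn (a := -R) (b := -‖z‖)
    ⟨by linarith, by linarith⟩ ⟨by linarith, by linarith⟩ (by linarith)
  linarith

theorem normalizedOn_of_le_one {f : ℂ → ℂ} {r : ℝ} (h : NormalizedOn 1 f) (hr : r ≤ 1) :
    NormalizedOn r f :=
  ⟨h.1.mono (ball_subset_ball hr), h.2⟩

theorem starlikeOfOrder_of_mem_F3 {f : ℂ → ℂ} (hf : f ∈ F3) {α R r : ℝ} (h0 : 0 ≤ α)
    (hR1 : R < 1) (hR : extremalQuotient (-R) = α) (hr : r < R) : StarlikeOfOrder α r f := by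
  have hre : ∀ z ∈ ball (0 : ℂ) r, α < (starQuotient f z).re := fun z hz => by
    have h1 := norm_starQuotient_sub_one_lt hf hR1 ((mem_ball_zero_iff.mp hz).trans hr)
    have h2 := (Complex.abs_re_le_norm _).trans_lt h1
    rw [hR, Complex.sub_re, Complex.one_re, abs_lt] at h2
    linarith [h2.1]
  have hN := normalizedOn_of_le_one hf.1 (hr.trans hR1).le
  refine ⟨hN, injOn_ball_of_starlike hN.1 hN.2.1 (by simp [hN.2.2]) fun z hz hz0 => ?_, hre⟩
  have := h0.trans_lt (hre z hz)
  rwa [starQuotient, if_neg hz0] at this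

theorem ofReal_mem_ball {x r : ℝ} (h : |x| < r) : (x : ℂ) ∈ ball (0 : ℂ) r := by
  rw [mem_ball_zero_iff, Complex.norm_real]; exact h

theorem isSharpRadius_starlikeOfOrder {α R : ℝ} (h0 : 0 ≤ α) (hR0 : 0 < R) (hR1 : R < 1)
    (hR : extremalQuotient (-R) = α) : IsSharpRadius (StarlikeOfOrder α) F3 f3 R := by
  refine isSharpRadius_of_forall hR0 hR1 f3_mem_F3
    (fun f hf r _ hr => starlikeOfOrder_of_mem_F3 hf h0 hR1 hR hr) fun r hr _ h => ?_
  have := h.2.2 ((-R : ℝ) : ℂ) (ofReal_mem_ball (by rw [abs_neg, abs_of_pos hR0]; exact hr))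
  rw [starQuotient_f3 (by linarith) (by linarith), hR, Complex.ofReal_re] at this
  exact lt_irrefl _ this

/-- If `s f3 x` is omitted by `φ` on the unit disk then `f3` is not in the class of `φ` on any
disk that contains `x`. -/
theorem not_starlikeSubord_f3 {φ : ℂ → ℂ} {x r : ℝ} (hx : |x| < 1) (hr : |x| < r)
    (hφ : ∀ ω ∈ ball (0 : ℂ) 1, φ ω ≠ (extremalQuotient x : ℂ)) : ¬ StarlikeSubord φ r f3 := by
  rintro ⟨-, -, ω, -, hmaps, -, hs⟩
  have hmem := ofReal_mem_ball hr
  have := hs x hmem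
  rw [starQuotient_f3 (abs_lt.mp hx).1 (abs_lt.mp hx).2] at this
  exact hφ _ (hmaps hmem) this.symm

/-- Analytic functions with values in `|w - 1| < m` are subordinate to `φ`. -/
def SubordinatesDisk (φ : ℂ → ℂ) (m : ℝ) : Prop :=
  ∀ (r : ℝ) (s : ℂ → ℂ), DifferentiableOn ℂ s (ball 0 r) → s 0 = 1 →
    (∀ z ∈ ball (0 : ℂ) r, ‖s z - 1‖ < m) → SubordinateOn r s φ

theorem starlikeSubord_of_mem_F3 {f : ℂ → ℂ} (hf : f ∈ F3) {φ : ℂ → ℂ} {r : ℝ} (hr : r ≤ 1)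
    (h : SubordinateOn r (starQuotient f) φ) : StarlikeSubord φ r f :=
  ⟨normalizedOn_of_le_one hf.1 hr,
    fun _ hz hz0 => ne_zero_of_mem_F3 hf ((mem_ball_zero_iff.mp hz).trans_le hr) hz0, h⟩

/-- Common scheme for six classes, with α playing the role of φ(-1). By monotonicity of
`extremalQuotient`, its values at -(x ± ε) locate R within ε of x. -/
theorem exists_radius_of_subordinatesDisk {φ : ℂ → ℂ} {α x ε : ℝ} (h0 : 0 ≤ α) (h1 : α < 1)
    (hφ : SubordinatesDisk φ (1 - α)) (hα : ∀ ω ∈ ball (0 : ℂ) 1, φ ω ≠ (α : ℂ))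
    (hε : 0 < ε) (hx1 : x + ε < 1) (hx2 : 0 < x - ε)
    (hlow : extremalQuotient (-(x + ε)) < α)
    (hup : α < extremalQuotient (-(x - ε))) :
    ∃ R : ℝ, IsSharpRadius (StarlikeSubord φ) F3 f3 R ∧
      IsRadius (StarlikeOfOrder α) F3 R ∧ |R - x| < ε := by
  obtain ⟨R, hR0, hR1, hR⟩ := exists_extremalQuotient_neg_eq h0 h1
  refine ⟨R, ?_, (isSharpRadius_starlikeOfOrder h0 hR0 hR1 hR).1, ?_⟩
  · have habs : |-R| = R := by rw [abs_neg, abs_of_pos hR0]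
    refine isSharpRadius_of_forall hR0 hR1 f3_mem_F3 (fun f hf r _ hr => ?_) fun r hr _ => ?_
    · refine starlikeSubord_of_mem_F3 hf (hr.trans hR1).le (hφ _ _
        ((differentiableOn_starQuotient hf).mono (ball_subset_ball (hr.trans hR1).le))
        (by simp [starQuotient]) fun z hz => ?_)
      rw [← hR]
      exact norm_starQuotient_sub_one_lt hf hR1 ((mem_ball_zero_iff.mp hz).trans hr)
    · exact not_starlikeSubord_f3 (x := -R) (by rwa [habs]) (by rwa [habs]) (by rwa [hR])
  · rw [← hR] at hlow hup
    rw [abs_lt]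
    have hmono := extremalQuotient_strictMonoOn.monotoneOn
    constructor
    · by_contra h
      push Not at h
      exact hup.not_ge (hmono (a := -(x - ε)) (b := -R) ⟨by linarith, by linarith⟩
        ⟨by linarith, by linarith⟩ (by linarith))
    · by_contra h
      push Not at h
      exact hlow.not_ge (hmono (a := -R) (b := -(x + ε)) ⟨by linarith, by linarith⟩
        ⟨by linarith, by linarith⟩ (by linarith))

/-- The cubic is (1 - r²)(2 - r) times the difference of the two sides on the right. -/
theorem starlike_cubic_eq_zero_iff {α r : ℝ} (h0 : 0 < r) (h1 : r < 1) :
    (2 - α) * r ^ 3 + 2 * α * r ^ 2 + (α - 6) * r + 2 - 2 * α = 0 ↔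
      extremalQuotient (-r) = α := by
  have hr : 0 < 1 - r ^ 2 := by nlinarith
  have hr2 : 0 < 2 - r := by linarith
  have e : extremalQuotient (-r) - α =
      ((2 - α) * r ^ 3 + 2 * α * r ^ 2 + (α - 6) * r + 2 - 2 * α) / ((1 - r ^ 2) * (2 - r)) := by
    simp only [extremalQuotient, neg_sq, ← sub_eq_add_neg]
    field_simp
    ring
  rw [← sub_eq_zero (b := α), e, div_eq_zero_iff, or_iff_left (by positivity)]

theorem exists_starlike_radius {α : ℝ} (h0 : 0 ≤ α) (h1 : α < 1) :
    ∃ R : ℝ, IsSharpRadius (StarlikeOfOrder α) F3 f3 R ∧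
      IsLeast {r : ℝ | 0 < r ∧
        (2 - α) * r ^ 3 + 2 * α * r ^ 2 + (α - 6) * r + 2 - 2 * α = 0} R := by
  obtain ⟨R, hR0, hR1, hR⟩ := exists_extremalQuotient_neg_eq h0 h1
  refine ⟨R, isSharpRadius_starlikeOfOrder h0 hR0 hR1 hR,
    ⟨hR0, (starlike_cubic_eq_zero_iff hR0 hR1).mpr hR⟩, fun r ⟨hr0, hr⟩ => ?_⟩
  rcases lt_or_ge r 1 with hr1 | hr1
  · rw [starlike_cubic_eq_zero_iff hr0 hr1, ← hR] at hr
    have := extremalQuotient_strictMonoOn.injOn (x₁ := -r) (x₂ := -R) ⟨by linarith, by linarith⟩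
      ⟨by linarith, by linarith⟩ hr
    linarith
  · linarith

/-! ### The lemniscate -/

theorem lemniscate_cubic_eq_zero_iff {r : ℝ} (h0 : 0 < r) (h1 : r < 1) :
    (Real.sqrt 2 - 2) * r ^ 3 + 2 * Real.sqrt 2 * r ^ 2 + (6 - Real.sqrt 2) * r
      + 2 - 2 * Real.sqrt 2 = 0 ↔ extremalQuotient r = Real.sqrt 2 := by
  have hr : 0 < 1 - r ^ 2 := by nlinarith
  have e : extremalQuotient r - Real.sqrt 2 =
      ((Real.sqrt 2 - 2) * r ^ 3 + 2 * Real.sqrt 2 * r ^ 2 + (6 - Real.sqrt 2) * r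
      + 2 - 2 * Real.sqrt 2) / ((1 - r ^ 2) * (2 + r)) := by
    simp only [extremalQuotient]
    field_simp
    ring
  rw [← sub_eq_zero (b := Real.sqrt 2), e, div_eq_zero_iff, or_iff_left (by positivity)]

/-- The circle about c through the vertex √2 must not be flatter there than the lemniscate, whose
radius of curvature at the vertex is √2/3; hence c ≥ 2√2/3. -/
theorem norm_sq_sub_one_lt_one_of_mem_disk {w : ℂ} {c d : ℝ} (hc : 2 * Real.sqrt 2 / 3 ≤ c)
    (hc1 : c ≤ 1) (hd : d < Real.sqrt 2 - c) (hw : ‖w - c‖ ≤ d) :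
    0 < w.re ∧ ‖w ^ 2 - 1‖ < 1 := by
  have hs : Real.sqrt 2 ^ 2 = 2 := Real.sq_sqrt (by norm_num)
  have hs1 : 1.414 < Real.sqrt 2 := by
    rw [Real.lt_sqrt (by norm_num)]; norm_num
  have hre := (Complex.abs_re_le_norm _).trans hw
  rw [Complex.sub_re, Complex.ofReal_re, abs_le] at hre
  have hd0 := (norm_nonneg _).trans hw
  set s := Real.sqrt 2
  have hx : 0 < w.re := by linarith [hre.1]
  refine ⟨hx, ?_⟩
  have hsq : ‖w - c‖ ^ 2 ≤ (s - c) ^ 2 := by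
    have := norm_nonneg (w - c)
    exact pow_le_pow_left₀ this (hw.trans hd.le) 2
  rw [Complex.sq_norm, Complex.normSq_apply] at hsq
  simp only [Complex.sub_re, Complex.ofReal_re, Complex.sub_im, Complex.ofReal_im, sub_zero] at hsq
  set x := w.re
  set y := w.im
  have ht : 0 < s - x := by linarith [hre.2]
  have hN : x ^ 2 + y ^ 2 ≤ 2 - 2 * c * (s - x) := by nlinarith
  have hN0 : 0 ≤ x ^ 2 + y ^ 2 := by positivity
  have hN2 : (x ^ 2 + y ^ 2) ^ 2 ≤ (2 - 2 * c * (s - x)) ^ 2 := pow_le_pow_left₀ hN0 hN 2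
  -- With N = x² + y², the interior is N² < 2(x² - y²) = 4x² - 2N. Inserting the bound `hN` on N
  -- leaves a gap of at least this product. At c = 1 its quadratic part vanishes and 12 > 8√2 is
  -- used instead.
  have hstrict : 0 < (s - x) * (12 * c - 8 * s + 4 * (s - x) * (1 - c ^ 2)) := by
    rcases hc1.lt_or_eq with h | h
    · have : 0 < (s - x) * (1 - c ^ 2) := mul_pos ht (by nlinarith)
      exact mul_pos ht (by linarith)
    · have : s < 1.4143 := by rw [Real.sqrt_lt' (by norm_num)]; norm_num
      rw [h]; exact mul_pos ht (by linarith)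
  have hmain : (x ^ 2 + y ^ 2) ^ 2 < 2 * (x ^ 2 - y ^ 2) := by nlinarith
  rw [← sq_lt_sq₀ (norm_nonneg _) zero_le_one, Complex.sq_norm, Complex.normSq_apply]
  simp only [sq w, Complex.sub_re, Complex.mul_re, Complex.one_re, Complex.sub_im, Complex.mul_im,
    Complex.one_im]
  change (x * x - y * y - 1) * (x * x - y * y - 1) +
    (x * y + y * x - 0) * (x * y + y * x - 0) < 1 ^ 2
  nlinarith

theorem exists_lemniscate_radius :
    ∃ R : ℝ, IsSharpRadius (StarlikeSubord phiL) F3 f3 R ∧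
        IsLeast {r : ℝ | 0 < r ∧
          (Real.sqrt 2 - 2) * r ^ 3 + 2 * Real.sqrt 2 * r ^ 2 + (6 - Real.sqrt 2) * r
            + 2 - 2 * Real.sqrt 2 = 0} R ∧
        |R - 0.1645| < 0.00005 := by
  have hs1 : 1.41420 < Real.sqrt 2 := by rw [Real.lt_sqrt (by norm_num)]; norm_num
  have hs2 : Real.sqrt 2 < 1.41422 := by rw [Real.sqrt_lt' (by norm_num)]; norm_num
  have hc : ContinuousOn extremalQuotient (Icc (0.16445) 0.16455) :=
    extremalQuotient_continuousOn.mono fun x hx =>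
      ⟨by linarith [hx.1], by linarith [hx.2]⟩
  obtain ⟨R, ⟨hRl, hRu⟩, hR⟩ := intermediate_value_Ioo (by norm_num) hc
    (show Real.sqrt 2 ∈ Ioo _ _ from
      ⟨lt_trans (by norm_num [extremalQuotient]) hs1, hs2.trans (by norm_num [extremalQuotient])⟩)
  have hR0 : 0 < R := by linarith
  have hR1 : R < 1 := by linarith
  refine ⟨R, ?_, ⟨⟨hR0, (lemniscate_cubic_eq_zero_iff hR0 hR1).mpr hR⟩, fun r ⟨hr0, hr⟩ => ?_⟩,
    by rw [abs_lt]; constructor <;> linarith⟩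
  · refine isSharpRadius_of_forall hR0 hR1 f3_mem_F3 (fun f hf r _ hr => ?_) fun r hr _ => ?_
    · have hd := (differentiableOn_starQuotient hf).mono (ball_subset_ball (hr.trans hR1).le)
      have key : ∀ z ∈ ball (0 : ℂ) r,
          0 < (starQuotient f z).re ∧ ‖starQuotient f z ^ 2 - 1‖ < 1 := fun z hz => by
        have hz : ‖z‖ < R := (mem_ball_zero_iff.mp hz).trans hr
        have hn := norm_nonneg z
        have hle := norm_starQuotient_sub_center_le hf (hz.trans hR1)
        have h4 : 0 < 4 - ‖z‖ ^ 2 := by nlinarith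
        refine norm_sq_sub_one_lt_one_of_mem_disk ?_ ?_ ?_ hle
        -- The centre is thus at least 0.99, above 2√2/3 ≈ 0.943.
        · have : ‖z‖ ^ 2 / (4 - ‖z‖ ^ 2) ≤ 0.01 := by
            rw [div_le_iff₀ h4]; nlinarith
          linarith
        · have : 0 ≤ ‖z‖ ^ 2 / (4 - ‖z‖ ^ 2) := by positivity
          linarith
        · have := extremalQuotient_strictMonoOn (a := ‖z‖) (b := R) ⟨by linarith, by linarith⟩
            ⟨by linarith, by linarith⟩ hz
          linarith
      refine starlikeSubord_of_mem_F3 hf (hr.trans hR1).le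
        ⟨fun z => starQuotient f z ^ 2 - 1, (hd.pow 2).sub_const 1, fun z hz => ?_,
          by simp [starQuotient], fun z hz => ?_⟩
      · exact mem_ball_zero_iff.mpr (key z hz).2
      · rw [phiL, add_sub_cancel, one_div]
        exact (Complex.sq_cpow_two_inv (key z hz).1).symm
    · have habs := abs_of_pos hR0
      refine not_starlikeSubord_f3 (x := R) (by rwa [habs]) (by rwa [habs]) fun ω hω h => ?_
      have h2 : phiL ω ^ 2 = 1 + ω := by
        rw [phiL, one_div]; exact Complex.cpow_ofNat_inv_pow _ 2
      rw [h, hR, ← Complex.ofReal_pow, Real.sq_sqrt (by norm_num)] at h2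
      have : ω = 1 := by push_cast at h2; linear_combination -h2
      simp [this] at hω
  · rcases lt_or_ge r 1 with hr1 | hr1
    · rw [lemniscate_cubic_eq_zero_iff hr0 hr1, ← hR] at hr
      exact (extremalQuotient_strictMonoOn.injOn (x₁ := r) (x₂ := R) ⟨by linarith, by linarith⟩
        ⟨by linarith, by linarith⟩ hr).ge
    · linarith

/-! ### Criteria for subordination -/

theorem subordinatesDisk_of_rightInverse {φ g : ℂ → ℂ} {m : ℝ}
    (hg : DifferentiableOn ℂ g (ball 1 m)) (hmaps : MapsTo g (ball 1 m) (ball 0 1))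
    (h1 : g 1 = 0) (hφ : ∀ w ∈ ball (1 : ℂ) m, φ (g w) = w) : SubordinatesDisk φ m := by
  intro r s hs hs0 hsm
  have hmem : MapsTo s (ball 0 r) (ball 1 m) := fun z hz => by
    rw [mem_ball, dist_eq_norm]; exact hsm z hz
  exact ⟨g ∘ s, hg.comp hs hmem, hmaps.comp hmem, by simp [hs0, h1], fun z hz =>
    (hφ _ (hmem hz)).symm⟩

/-- A criterion for subordination: `φ` is univalent on the unit disk and `m ≤ |φ - 1|` on the circle. -/
theorem subordinatesDisk_of_injOn {φ : ℂ → ℂ} {m : ℝ} {U : Set ℂ} (hm : 0 < m) (hU : IsOpen U)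
    (hsub : closedBall 0 1 ⊆ U) (hφU : DifferentiableOn ℂ φ U) (h0 : φ 0 = 1)
    (hinj : InjOn φ (ball 0 1)) (hder : ∀ z ∈ ball (0 : ℂ) 1, deriv φ z ≠ 0)
    (hcirc : ∀ z : ℂ, ‖z‖ = 1 → m ≤ ‖φ z - 1‖) : SubordinatesDisk φ m := by
  obtain ⟨g, hg, hmaps, hg0, hinv⟩ := exists_analytic_inverse (h := fun z => φ z - 1) hU hsub
    (hφU.sub_const 1) (by simp [h0]) (fun x hx y hy h => hinj hx hy (sub_left_injective h))
    (by simpa using hder) hcirc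
  have hshift : MapsTo (fun w : ℂ => w - 1) (ball 1 m) (ball 0 m) := fun w hw => by
    rwa [mem_ball_zero_iff, ← dist_eq_norm]
  refine subordinatesDisk_of_rightInverse (g := fun w => g (w - 1))
    (hg.comp (by fun_prop) hshift) (hmaps.comp hshift) (by simpa using hg0 hm) fun w hw => ?_
  have := hinv _ (hshift hw)
  simpa using this

/-! ### The exponential function -/

/-- Termwise comparison of Taylor series. It shows that the logarithm maps |w - 1| < 1 - 1/e into
the unit disk. -/
theorem norm_log_one_add_le_neg_log {u : ℂ} (hu : ‖u‖ < 1) :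
    ‖Complex.log (1 + u)‖ ≤ -Real.log (1 - ‖u‖) := by
  have h1 := Complex.hasSum_taylorSeries_neg_log' (z := -u) (by rwa [norm_neg])
  have h2 := Real.hasSum_pow_div_log_of_abs_lt_one (x := ‖u‖) (by rwa [abs_norm])
  rw [sub_neg_eq_add] at h1
  rw [← norm_neg]
  refine h1.norm_le_of_bounded h2 fun n => ?_
  rw [norm_div, norm_pow, norm_neg]
  apply le_of_eq
  congr 1
  exact_mod_cast Complex.norm_natCast (n + 1)

theorem subordinatesDisk_phiE : SubordinatesDisk phiE (1 - 1 / Real.exp 1) := by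
  have he : 0 < 1 / Real.exp 1 := by positivity
  have hlt : ∀ w ∈ ball (1 : ℂ) (1 - 1 / Real.exp 1), ‖w - 1‖ < 1 - 1 / Real.exp 1 :=
    fun w hw => by rwa [← dist_eq_norm]
  have hslit : ∀ w ∈ ball (1 : ℂ) (1 - 1 / Real.exp 1), w ∈ Complex.slitPlane := fun w hw => by
    have := Complex.mem_slitPlane_of_norm_lt_one (z := w - 1) (by linarith [hlt w hw])
    rwa [add_sub_cancel] at this
  refine subordinatesDisk_of_rightInverse (g := Complex.log)
    (fun w hw => (Complex.differentiableAt_log (hslit w hw)).differentiableWithinAt)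
    (fun w hw => ?_) (by simp) fun w hw => Complex.exp_log (Complex.slitPlane_ne_zero (hslit w hw))
  have h := hlt w hw
  have h1 := norm_log_one_add_le_neg_log (u := w - 1) (by linarith)
  rw [add_sub_cancel] at h1
  have h2 : Real.log (1 / Real.exp 1) < Real.log (1 - ‖w - 1‖) :=
    Real.log_lt_log he (by linarith)
  rw [one_div, Real.log_inv, Real.log_exp] at h2
  rw [mem_ball_zero_iff]
  linarith

theorem phiE_ne {ω : ℂ} (hω : ω ∈ ball (0 : ℂ) 1) : phiE ω ≠ ((1 / Real.exp 1 : ℝ) : ℂ) := by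
  intro h
  have h1 : ‖Complex.exp ω‖ = Real.exp (-1) := by
    rw [show Complex.exp ω = _ from h, Complex.norm_of_nonneg (by positivity), Real.exp_neg,
      one_div]
  rw [Complex.norm_exp, Real.exp_eq_exp] at h1
  have h2 := Complex.abs_re_le_norm ω
  rw [mem_ball_zero_iff] at hω
  rw [h1] at h2
  norm_num at h2
  linarith

/-! ### The cardioid -/

theorem subordinatesDisk_phiC : SubordinatesDisk phiC (1 - 1 / 3) := by
  have hder : ∀ z : ℂ, HasDerivAt phiC (4 / 3 * (1 + z)) z := fun z =>
    ((((hasDerivAt_id z).const_mul (4 / 3 : ℂ)).const_add 1).add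
      ((hasDerivAt_pow 2 z).const_mul (2 / 3 : ℂ))).congr_deriv (by simp; ring)
  refine subordinatesDisk_of_injOn (by norm_num) isOpen_univ (subset_univ _)
    (fun z _ => (hder z).differentiableAt.differentiableWithinAt) (by simp [phiC]) ?_ ?_ ?_
  · intro x hx y hy h
    rw [mem_ball_zero_iff] at hx hy
    have h1 : (x - y) * (2 + (x + y)) = 0 := by
      simp only [phiC] at h; linear_combination (3 / 2 : ℂ) * h
    rcases mul_eq_zero.mp h1 with h2 | h2
    · exact sub_eq_zero.mp h2
    · exfalso
      have h3 := norm_add_le x y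
      rw [show x + y = -2 by linear_combination h2] at h3
      norm_num at h3
      linarith
  · intro z hz h
    rw [(hder z).deriv] at h
    have h1 : z = -1 := by linear_combination (3 / 4 : ℂ) * h
    simp [h1] at hz
  · intro z hz
    have h1 : phiC z - 1 = z * (4 / 3 + 2 / 3 * z) := by simp only [phiC]; ring
    rw [h1, norm_mul, hz, one_mul]
    have h2 := norm_sub_le_norm_add (4 / 3 : ℂ) (2 / 3 * z)
    rw [norm_mul, hz] at h2
    norm_num at h2 ⊢
    linarith

/-- 1/3 is the critical value at -1: φ(ω) - 1/3 = (2/3)(ω + 1)². -/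
theorem phiC_ne {ω : ℂ} (hω : ω ∈ ball (0 : ℂ) 1) : phiC ω ≠ ((1 / 3 : ℝ) : ℂ) := by
  intro h
  have h1 : (ω + 1) ^ 2 = 0 := by
    simp only [phiC] at h
    push_cast at h
    linear_combination (3 / 2 : ℂ) * h
  have h2 : ω = -1 := by linear_combination pow_eq_zero_iff (two_ne_zero) |>.mp h1
  simp [h2] at hω

/-! ### The sine function -/

theorem sin_ne_zero_of_norm_lt_pi {z : ℂ} (hz : ‖z‖ < Real.pi) (h0 : z ≠ 0) :
    Complex.sin z ≠ 0 := by
  intro h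
  obtain ⟨k, rfl⟩ := Complex.sin_eq_zero_iff.mp h
  rw [norm_mul, Complex.norm_of_nonneg Real.pi_pos.le, Complex.norm_intCast] at hz
  have h1 : |(k : ℝ)| < 1 := by
    by_contra hk
    push Not at hk
    nlinarith [Real.pi_pos]
  have h2 : k = 0 := Int.abs_lt_one_iff.mp (by exact_mod_cast h1)
  simp [h2] at h0

theorem cos_ne_zero_of_norm_lt_pi_div_two {z : ℂ} (hz : ‖z‖ < Real.pi / 2) :
    Complex.cos z ≠ 0 := by
  rw [← Complex.sin_pi_div_two_sub]
  have hpi : ‖(Real.pi / 2 : ℂ)‖ = Real.pi / 2 := by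
    rw [norm_div, Complex.norm_of_nonneg Real.pi_pos.le, Complex.norm_ofNat]
  refine sin_ne_zero_of_norm_lt_pi ?_ ?_
  · have := norm_sub_le (Real.pi / 2 : ℂ) z
    linarith
  · intro h
    rw [← sub_eq_zero.mp h, hpi] at hz
    exact lt_irrefl _ hz

theorem sin_ne_sin {x y : ℂ} (h : ‖x‖ + ‖y‖ < Real.pi) (hxy : x ≠ y) :
    Complex.sin x ≠ Complex.sin y := by
  have h1 : ‖(x - y) / 2‖ < Real.pi / 2 := by
    rw [norm_div, Complex.norm_ofNat]
    have := norm_sub_le x y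
    linarith
  have h2 : ‖(x + y) / 2‖ < Real.pi / 2 := by
    rw [norm_div, Complex.norm_ofNat]
    have := norm_add_le x y
    linarith
  rw [← sub_ne_zero, Complex.sin_sub_sin]
  exact mul_ne_zero (mul_ne_zero two_ne_zero (sin_ne_zero_of_norm_lt_pi
    (by linarith [Real.pi_pos]) (div_ne_zero (sub_ne_zero.mpr hxy) two_ne_zero)))
    (cos_ne_zero_of_norm_lt_pi_div_two h2)

theorem normSq_sin (z : ℂ) :
    Complex.normSq (Complex.sin z) = Real.sin z.re ^ 2 + Real.sinh z.im ^ 2 := by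
  have e : Complex.sin z = ((Real.sin z.re * Real.cosh z.im : ℝ) : ℂ) +
      ((Real.cos z.re * Real.sinh z.im : ℝ) : ℂ) * Complex.I := by
    rw [Complex.sin_eq]; push_cast; ring
  rw [e, Complex.normSq_add_mul_I, mul_pow, mul_pow, Real.cosh_sq, Real.cos_sq']
  ring

theorem sin_one_pos : 0 < Real.sin 1 :=
  Real.sin_pos_of_pos_of_lt_pi one_pos (by linarith [Real.pi_gt_three])

/-- With z = x + iy, |sin z|² = sin² x + sinh² y, where sinh² y ≥ y² = 1 - x² and sin² 1 - sin² x =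
sin(1 + x) sin(1 - x) ≤ 1 - x². -/
theorem sin_one_le_norm_sin {z : ℂ} (hz : ‖z‖ = 1) : Real.sin 1 ≤ ‖Complex.sin z‖ := by
  rw [← sq_le_sq₀ sin_one_pos.le (norm_nonneg _), Complex.sq_norm, normSq_sin]
  have hxy : z.re ^ 2 + z.im ^ 2 = 1 := by
    have := Complex.sq_norm z
    rw [hz, Complex.normSq_apply] at this
    linarith
  have h1 : z.im ^ 2 ≤ Real.sinh z.im ^ 2 := by
    rw [sq_le_sq, Real.abs_sinh]
    exact Real.self_le_sinh_iff.mpr (abs_nonneg _)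
  have h2 : Real.sin 1 ^ 2 - Real.sin z.re ^ 2 ≤ 1 - z.re ^ 2 := by
    have e : Real.sin 1 ^ 2 - Real.sin z.re ^ 2 =
        Real.sin (1 + z.re) * Real.sin (1 - z.re) := by
      rw [Real.sin_add, Real.sin_sub]
      have := Real.sin_sq_add_cos_sq 1
      have := Real.sin_sq_add_cos_sq z.re
      grind
    have hx := Complex.abs_re_le_norm z
    rw [hz, abs_le] at hx
    rw [e]
    calc _ ≤ |Real.sin (1 + z.re)| * |Real.sin (1 - z.re)| := by
          rw [← abs_mul]; exact le_abs_self _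
      _ ≤ |1 + z.re| * |1 - z.re| :=
          mul_le_mul Real.abs_sin_le_abs Real.abs_sin_le_abs (abs_nonneg _) (abs_nonneg _)
      _ = 1 - z.re ^ 2 := by
          rw [abs_of_nonneg (by linarith), abs_of_nonneg (by linarith)]; ring
  linarith

theorem subordinatesDisk_phiSin : SubordinatesDisk phiSin (Real.sin 1) := by
  refine subordinatesDisk_of_injOn sin_one_pos isOpen_univ (subset_univ _)
    (Complex.differentiable_sin.const_add 1).differentiableOn (by simp [phiSin]) ?_ ?_ ?_
  · intro x hx y hy h
    rw [mem_ball_zero_iff] at hx hy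
    by_contra hne
    exact sin_ne_sin (by linarith [Real.pi_gt_three]) hne (add_left_cancel h)
  · intro z hz
    have : deriv phiSin z = Complex.cos z := ((Complex.hasDerivAt_sin z).const_add 1).deriv
    rw [mem_ball_zero_iff] at hz
    rw [this]
    exact cos_ne_zero_of_norm_lt_pi_div_two (by linarith [Real.pi_gt_three])
  · intro z hz
    rw [phiSin, add_sub_cancel_left]
    exact sin_one_le_norm_sin hz

theorem phiSin_ne {ω : ℂ} (hω : ω ∈ ball (0 : ℂ) 1) :
    phiSin ω ≠ ((1 - Real.sin 1 : ℝ) : ℂ) := by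
  intro h
  rw [mem_ball_zero_iff] at hω
  refine sin_ne_sin (x := ω) (y := -1) ?_ ?_ ?_
  · rw [norm_neg, norm_one]; linarith [Real.pi_gt_three]
  · rintro rfl; simp at hω
  · rw [phiSin] at h
    push_cast at h
    rw [Complex.sin_neg]
    linear_combination h

theorem sin_one_bounds : 0.84133 < Real.sin 1 ∧ Real.sin 1 < 0.84149 := by
  -- The Taylor remainder bound is much tighter at 1/3 than at 1; the triple-angle formula carries
  -- it over.
  have h := Real.sin_bound (x := 1 / 3) (by norm_num [abs_le])
  rw [abs_of_pos (show (0 : ℝ) < 1 / 3 by norm_num), abs_le] at h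
  have e : Real.sin 1 = 3 * Real.sin (1 / 3) - 4 * Real.sin (1 / 3) ^ 3 := by
    rw [← Real.sin_three_mul]; norm_num
  obtain ⟨h1, h2⟩ := h
  have hl : 0.327119 ≤ Real.sin (1 / 3) := by norm_num at h1 ⊢; linarith
  have hu : Real.sin (1 / 3) ≤ 0.327203 := by norm_num at h2 ⊢; linarith
  rw [e]
  set s := Real.sin (1 / 3)
  constructor <;> nlinarith [mul_nonneg (sub_nonneg.mpr hl) (sub_nonneg.mpr hu)]

/-! ### The lune -/

theorem sqrt_two_sq : Real.sqrt 2 ^ 2 = 2 := Real.sq_sqrt (by norm_num)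

theorem sqrt_two_gt : 1.41421 < Real.sqrt 2 := by rw [Real.lt_sqrt (by norm_num)]; norm_num

theorem sqrt_two_lt : Real.sqrt 2 < 1.41422 := by rw [Real.sqrt_lt' (by norm_num)]; norm_num

/-- For Re w > 0, |w - 1/w| < 2 describes the lune |w - 1| < √2 < |w + 1|; the disk touches its
inner arc at √2 - 1. -/
theorem re_pos_and_norm_sub_inv_lt {w : ℂ} (hw : ‖w - 1‖ < 2 - Real.sqrt 2) :
    0 < w.re ∧ ‖w - w⁻¹‖ < 2 := by
  have hs := sqrt_two_sq
  have hs1 := sqrt_two_gt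
  have hs2 := sqrt_two_lt
  have hre := (Complex.abs_re_le_norm _).trans_lt hw
  rw [Complex.sub_re, Complex.one_re, abs_lt] at hre
  have hx : Real.sqrt 2 - 1 < w.re := by linarith [hre.1]
  have hx0 : 0 < w.re := by linarith
  refine ⟨hx0, ?_⟩
  have hw0 : w ≠ 0 := fun h => by simp [h] at hx0
  have hsq : ‖w - 1‖ ^ 2 < (2 - Real.sqrt 2) ^ 2 := pow_lt_pow_left₀ hw (norm_nonneg _) two_ne_zero
  rw [Complex.sq_norm, Complex.normSq_apply] at hsq
  simp only [Complex.sub_re, Complex.one_re, Complex.sub_im, Complex.one_im, sub_zero] at hsq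
  rw [show w - w⁻¹ = (w ^ 2 - 1) / w by field_simp, norm_div, div_lt_iff₀ (norm_pos_iff.mpr hw0),
    ← sq_lt_sq₀ (norm_nonneg _) (by positivity), mul_pow, Complex.sq_norm, Complex.sq_norm,
    Complex.normSq_apply, Complex.normSq_apply]
  simp only [sq w, Complex.sub_re, Complex.mul_re, Complex.one_re, Complex.sub_im, Complex.mul_im,
    Complex.one_im]
  set x := w.re
  set y := w.im
  have h1 : x ^ 2 + y ^ 2 - 1 < 2 * x := by nlinarith
  have h2 : -(2 * x) < x ^ 2 + y ^ 2 - 1 := by nlinarith [sq_nonneg y]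
  nlinarith [mul_pos (sub_pos.mpr h1) (sub_pos.mpr h2)]

theorem subordinatesDisk_phiLune : SubordinatesDisk phiLune (1 - (Real.sqrt 2 - 1)) := by
  rw [show 1 - (Real.sqrt 2 - 1) = 2 - Real.sqrt 2 by ring]
  have key : ∀ w ∈ ball (1 : ℂ) (2 - Real.sqrt 2), 0 < w.re ∧ ‖w - w⁻¹‖ < 2 := fun w hw =>
    re_pos_and_norm_sub_inv_lt (by rwa [← dist_eq_norm])
  have hne : ∀ w ∈ ball (1 : ℂ) (2 - Real.sqrt 2), w ≠ 0 := fun w hw h => by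
    simpa [h] using (key w hw).1
  refine subordinatesDisk_of_rightInverse (g := fun w => (w - w⁻¹) / 2) (fun w hw => ?_)
    (fun w hw => ?_) (by simp) fun w hw => ?_
  · have := hne w hw
    apply DifferentiableAt.differentiableWithinAt
    fun_prop (disch := assumption)
  · rw [mem_ball_zero_iff, norm_div, Complex.norm_ofNat]
    linarith [(key w hw).2]
  · have h0 := hne w hw
    have hre := (key w hw).1
    -- Since (w + 1/w)/2 has positive real part, it is the principal root, and adding (w - 1/w)/2
    -- gives w.
    have e : 1 + ((w - w⁻¹) / 2) ^ 2 = ((w + w⁻¹) / 2) ^ 2 := by field_simp; ring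
    have hpos : 0 < ((w + w⁻¹) / 2).re := by
      have : 0 < (w⁻¹).re := by
        rw [Complex.inv_re]; exact div_pos hre (Complex.normSq_pos.mpr h0)
      rw [Complex.div_ofNat_re, Complex.add_re]
      linarith
    rw [phiLune, e, one_div, Complex.sq_cpow_two_inv hpos]
    ring

theorem phiLune_ne {ω : ℂ} (hω : ω ∈ ball (0 : ℂ) 1) :
    phiLune ω ≠ ((Real.sqrt 2 - 1 : ℝ) : ℂ) := by
  intro h
  have hs : ((Real.sqrt 2 : ℝ) : ℂ) ^ 2 = 2 := by exact_mod_cast sqrt_two_sq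
  have hq : ((1 + ω ^ 2) ^ (1 / 2 : ℂ)) ^ 2 = 1 + ω ^ 2 := by
    rw [one_div]; exact Complex.cpow_ofNat_inv_pow _ 2
  rw [phiLune] at h
  push_cast at h
  rw [show (1 + ω ^ 2) ^ (1 / 2 : ℂ) = ((Real.sqrt 2 : ℝ) : ℂ) - 1 - ω by linear_combination h]
    at hq
  have hne : ((Real.sqrt 2 : ℝ) : ℂ) - 1 ≠ 0 := by
    have := sqrt_two_gt
    exact_mod_cast (by linarith : Real.sqrt 2 - 1 ≠ 0)
  have h1 : (((Real.sqrt 2 : ℝ) : ℂ) - 1) * (ω + 1) = 0 := by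
    linear_combination (-1 / 2 : ℂ) * hq + (1 / 2 : ℂ) * hs
  have h2 : ω = -1 := by linear_combination (mul_eq_zero.mp h1).resolve_left hne
  simp [h2] at hω

/-! ### The rational function -/

theorem subordinatesDisk_phiR : SubordinatesDisk phiR (1 - 2 * (Real.sqrt 2 - 1)) := by
  have hs := sqrt_two_sq
  have hs1 := sqrt_two_gt
  have hs2 := sqrt_two_lt
  set κ : ℝ := Real.sqrt 2 + 1 with hκ
  have hκ2 : κ ^ 2 = 2 * κ + 1 := by rw [hκ]; nlinarith
  have hκ2' : (κ : ℂ) ^ 2 = 2 * κ + 1 := by exact_mod_cast hκ2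
  have hκpos : 0 < κ := by linarith
  have hκ0 : (κ : ℂ) ≠ 0 := by exact_mod_cast hκpos.ne'
  have hnκ : ‖(κ : ℂ)‖ = κ := Complex.norm_of_nonneg hκpos.le
  have hφ : ∀ z : ℂ, phiR z = 1 + (κ * z + z ^ 2) / ((κ : ℂ) ^ 2 - κ * z) := fun z => rfl
  have hden : ∀ z : ℂ, ‖z‖ ≤ 1 → (κ : ℂ) ^ 2 - κ * z ≠ 0 := fun z hz h => by
    have h1 : (κ : ℂ) * (κ - z) = 0 := by linear_combination h
    have h2 := (mul_eq_zero.mp h1).resolve_left hκ0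
    rw [← sub_eq_zero.mp h2, hnκ] at hz
    linarith
  -- This factor of φ(x) - φ(y) cannot vanish because κ² = 2κ + 1 exceeds |xy - κ(x + y)|. The case
  -- x = y gives φ' ≠ 0.
  have hnum : ∀ x y : ℂ, ‖x‖ < 1 → ‖y‖ < 1 → (κ : ℂ) ^ 2 + κ * (x + y) - x * y ≠ 0 :=
    fun x y hx hy h => by
      have h1 : ‖(κ : ℂ) ^ 2‖ = ‖x * y - κ * (x + y)‖ := by congr 1; linear_combination h
      have h2 := norm_sub_le (x * y) (κ * (x + y))
      have h3 := norm_add_le x y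
      rw [← h1, norm_pow, norm_mul, norm_mul, hnκ, hκ2] at h2
      nlinarith [norm_nonneg x, norm_nonneg y]
  have hder : ∀ z : ℂ, (κ : ℂ) ^ 2 - κ * z ≠ 0 → HasDerivAt phiR
      (κ * (κ ^ 2 + κ * (z + z) - z * z) / ((κ : ℂ) ^ 2 - κ * z) ^ 2) z := fun z hz => by
    have h1 : HasDerivAt (fun z : ℂ => (κ : ℂ) * z + z ^ 2) (κ + 2 * z) z :=
      (((hasDerivAt_id z).const_mul (κ : ℂ)).add (hasDerivAt_pow 2 z)).congr_deriv (by simp)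
    have h2 : HasDerivAt (fun z : ℂ => (κ : ℂ) ^ 2 - κ * z) (-κ) z :=
      (((hasDerivAt_id z).const_mul (κ : ℂ)).const_sub _).congr_deriv (by simp)
    exact ((h1.div h2 hz).const_add 1).congr_deriv (by congr 1; ring)
  refine subordinatesDisk_of_injOn (U := {z | (κ : ℂ) ^ 2 - κ * z ≠ 0}) (by linarith)
    (isOpen_ne_fun (by fun_prop) continuous_const) (fun z hz => hden z (by simpa using hz))
    (fun z hz => (hder z hz).differentiableAt.differentiableWithinAt) (by simp [hφ]) ?_ ?_ ?_
  · intro x hx y hy h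
    rw [mem_ball_zero_iff] at hx hy
    rw [hφ, hφ, add_right_inj, div_eq_div_iff (hden x hx.le) (hden y hy.le)] at h
    have h1 : (κ : ℂ) * ((x - y) * ((κ : ℂ) ^ 2 + κ * (x + y) - x * y)) = 0 := by
      linear_combination h
    have h2 := (mul_eq_zero.mp h1).resolve_left hκ0
    exact sub_eq_zero.mp ((mul_eq_zero.mp h2).resolve_right (hnum x y hx hy))
  · intro z hz
    rw [mem_ball_zero_iff] at hz
    rw [(hder z (hden z hz.le)).deriv]
    exact div_ne_zero (mul_ne_zero hκ0 (hnum z z hz hz)) (pow_ne_zero 2 (hden z hz.le))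
  · intro z hz
    have e1 : ‖(κ : ℂ) * z + z ^ 2‖ = ‖(κ : ℂ) + z‖ := by
      rw [show (κ : ℂ) * z + z ^ 2 = z * (κ + z) by ring, norm_mul, hz, one_mul]
    have e2 : ‖(κ : ℂ) ^ 2 - κ * z‖ = κ * ‖(κ : ℂ) - z‖ := by
      rw [show (κ : ℂ) ^ 2 - κ * z = κ * (κ - z) by ring, norm_mul, hnκ]
    have h1 := norm_sub_le_norm_add (κ : ℂ) z
    have h2 := norm_sub_le (κ : ℂ) z
    rw [hφ, add_sub_cancel_left, norm_div, le_div_iff₀ (norm_pos_iff.mpr (hden z hz.le)), e1, e2]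
    rw [hnκ, hz] at h1 h2
    -- On the circle |φ - 1| = |κ + z|/(κ|κ - z|) is least at z = -1, with value (κ - 1)/(κ(κ + 1)).
    have hm : (1 - 2 * (Real.sqrt 2 - 1)) * (κ * (κ + 1)) = κ - 1 := by
      rw [hκ]; ring_nf
      rw [show Real.sqrt 2 ^ 3 = Real.sqrt 2 ^ 2 * Real.sqrt 2 by ring, hs]; ring
    have hm0 : 0 < 1 - 2 * (Real.sqrt 2 - 1) := by linarith
    calc _ ≤ (1 - 2 * (Real.sqrt 2 - 1)) * (κ * (κ + 1)) := by gcongr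
      _ ≤ _ := by rw [hm]; exact h1

theorem phiR_ne {ω : ℂ} (hω : ω ∈ ball (0 : ℂ) 1) :
    phiR ω ≠ ((2 * (Real.sqrt 2 - 1) : ℝ) : ℂ) := by
  intro h
  have hs1 := sqrt_two_gt
  have hs : ((Real.sqrt 2 : ℝ) : ℂ) ^ 2 = 2 := by exact_mod_cast sqrt_two_sq
  rw [mem_ball_zero_iff] at hω
  simp only [phiR] at h
  push_cast at h
  set s : ℂ := ((Real.sqrt 2 : ℝ) : ℂ) with hsdef
  have hnorm : ‖s + 1‖ = Real.sqrt 2 + 1 := by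
    rw [hsdef]
    exact_mod_cast Complex.norm_of_nonneg (by linarith : 0 ≤ Real.sqrt 2 + 1)
  have hκ0 : s + 1 ≠ 0 := fun h => by rw [h, norm_zero] at hnorm; linarith
  have hden : (s + 1) ^ 2 - (s + 1) * ω ≠ 0 := fun h => by
    have h1 : (s + 1) * (s + 1 - ω) = 0 := by linear_combination h
    have h2 := (mul_eq_zero.mp h1).resolve_left hκ0
    rw [← sub_eq_zero.mp h2, hnorm] at hω
    linarith
  have h1 : (s + 1) * ω + ω ^ 2 = (2 * (s - 1) - 1) * ((s + 1) ^ 2 - (s + 1) * ω) :=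
    (div_eq_iff hden).mp (by linear_combination h)
  have h2 : (ω + 1) ^ 2 = 0 := by
    linear_combination h1 + (2 * s + 1 - 2 * ω) * hs
  have h3 : ω = -1 := by linear_combination pow_eq_zero_iff (two_ne_zero) |>.mp h2
  simp [h3] at hω

/-! ### The parabola -/

/-- The entire function `x ↦ cosh √x`. -/
noncomputable def coshSqrt (x : ℂ) : ℂ := Complex.cosh (x ^ (2⁻¹ : ℂ))

theorem coshSqrt_eq_of_sq_eq {x y : ℂ} (h : y ^ 2 = x) : coshSqrt x = Complex.cosh y := by
  have h1 : (x ^ (2⁻¹ : ℂ)) ^ 2 = y ^ 2 := by rw [h]; exact Complex.cpow_ofNat_inv_pow _ 2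
  rcases sq_eq_sq_iff_eq_or_eq_neg.mp h1 with h2 | h2
  · rw [coshSqrt, h2]
  · rw [coshSqrt, h2, Complex.cosh_neg]

/-- Since cosh is even, the choice of root is immaterial: i√(-x) serves across the cut of √x, and
the singularity at 0 is removable by continuity. -/
theorem differentiable_coshSqrt : Differentiable ℂ coshSqrt := by
  have h1 : ∀ x ∈ Complex.slitPlane, DifferentiableAt ℂ coshSqrt x := fun x hx =>
    (differentiableAt_id.cpow_const hx).ccosh
  have h2 : ∀ x : ℂ, -x ∈ Complex.slitPlane → DifferentiableAt ℂ coshSqrt x := fun x hx => by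
    have e : coshSqrt = fun x => Complex.cosh (Complex.I * (-x) ^ (2⁻¹ : ℂ)) := by
      funext x
      refine coshSqrt_eq_of_sq_eq ?_
      have : ((-x) ^ (2⁻¹ : ℂ)) ^ 2 = -x := Complex.cpow_ofNat_inv_pow _ 2
      rw [mul_pow, this, Complex.I_sq, neg_one_mul, neg_neg]
    rw [e]
    exact ((differentiableAt_id.neg.cpow_const hx).const_mul _).ccosh
  have h3 : ∀ x : ℂ, x ≠ 0 → DifferentiableAt ℂ coshSqrt x := fun x hx => by
    by_cases h : x ∈ Complex.slitPlane
    · exact h1 x h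
    · refine h2 x ?_
      rw [Complex.mem_slitPlane_iff] at h ⊢
      push Not at h
      left
      rw [Complex.neg_re]
      refine neg_pos.mpr (lt_of_le_of_ne h.1 fun h0 => hx (Complex.ext h0 h.2))
  intro x
  rcases eq_or_ne x 0 with rfl | hx
  · refine (Complex.analyticAt_of_differentiable_on_punctured_nhds_of_continuousAt
      (eventually_nhdsWithin_of_forall h3) ?_).differentiableAt
    exact Complex.continuous_cosh.continuousAt.comp
      (Complex.continuousAt_cpow_const_of_re_pos (by simp) (by norm_num))
  · exact h3 x hx

theorem cosh_re_pos {z : ℂ} (hz : ‖z‖ < Real.pi / 2) : 0 < (Complex.cosh z).re := by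
  have e : Complex.cosh z = ((Real.cosh z.re * Real.cos z.im : ℝ) : ℂ) +
      ((Real.sinh z.re * Real.sin z.im : ℝ) : ℂ) * Complex.I := by
    conv_lhs => rw [← Complex.re_add_im z]
    rw [Complex.cosh_add, Complex.cosh_mul_I, Complex.sinh_mul_I]
    push_cast
    ring
  rw [e]
  have h := (Complex.abs_im_le_norm z).trans_lt hz
  rw [abs_lt] at h
  have := Real.cos_pos_of_mem_Ioo h
  have := Real.cosh_pos z.re
  simp only [Complex.add_re, Complex.ofReal_re, Complex.mul_re, Complex.I_re, Complex.ofReal_im,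
    Complex.I_im]
  nlinarith [mul_pos ‹0 < Real.cosh z.re› ‹0 < Real.cos z.im›]

/-- The argument is tanh²(y/2), and (1 + tanh(y/2))/(1 - tanh(y/2)) = e^y. The other root gives
e^(-y), with the same squared logarithm; |Im y| < π/2 keeps the logarithm principal. -/
theorem phiP_tanh_sq {y : ℂ} (hy : ‖y‖ < Real.pi / 2) :
    phiP ((Complex.cosh y - 1) / (Complex.cosh y + 1)) = 1 + 2 / (Real.pi : ℂ) ^ 2 * y ^ 2 := by
  have hcosh : Complex.cosh y + 1 ≠ 0 := fun h => by
    have := cosh_re_pos hy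
    rw [eq_neg_of_add_eq_zero_left h] at this
    norm_num at this
  set E := Complex.exp y with hE
  have hE0 : E ≠ 0 := Complex.exp_ne_zero y
  have hc : Complex.cosh y = (E + E⁻¹) / 2 := by rw [Complex.cosh, Complex.exp_neg]
  have hc1 : Complex.cosh y + 1 = (E + 1) ^ 2 / (2 * E) := by rw [hc]; field_simp; ring
  have hc2 : Complex.cosh y - 1 = (E - 1) ^ 2 / (2 * E) := by rw [hc]; field_simp; ring
  have hE1 : E + 1 ≠ 0 := fun h => hcosh (by rw [hc1, h]; simp)
  have hdiv : (Complex.cosh y - 1) / (Complex.cosh y + 1) = ((E - 1) / (E + 1)) ^ 2 := by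
    rw [hc1, hc2]; field_simp
  have him := (Complex.abs_im_le_norm y).trans_lt hy
  rw [abs_lt] at him
  have hpi := Real.pi_pos
  have hlog : ∀ t : ℂ, t ^ 2 = ((E - 1) / (E + 1)) ^ 2 →
      Complex.log ((1 + t) / (1 - t)) ^ 2 = y ^ 2 := fun t ht => by
    rcases sq_eq_sq_iff_eq_or_eq_neg.mp ht with rfl | rfl
    · have e : (1 + (E - 1) / (E + 1)) / (1 - (E - 1) / (E + 1)) = E := by
        rw [show 1 + (E - 1) / (E + 1) = 2 * E / (E + 1) by field_simp; ring,
          show 1 - (E - 1) / (E + 1) = 2 / (E + 1) by field_simp; ring]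
        field_simp
      rw [e, hE, Complex.log_exp (by linarith) (by linarith)]
    · have e : (1 + -((E - 1) / (E + 1))) / (1 - -((E - 1) / (E + 1))) = Complex.exp (-y) := by
        rw [show 1 + -((E - 1) / (E + 1)) = 2 / (E + 1) by field_simp; ring,
          show 1 - -((E - 1) / (E + 1)) = 2 * E / (E + 1) by field_simp; ring, Complex.exp_neg, ← hE]
        field_simp
      rw [e, Complex.log_exp (by rw [Complex.neg_im]; linarith) (by rw [Complex.neg_im]; linarith),
        neg_sq]
  rw [phiP, hlog]
  rw [hdiv, one_div]
  exact Complex.cpow_ofNat_inv_pow _ 2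

theorem subordinatesDisk_phiP : SubordinatesDisk phiP (1 - 1 / 2) := by
  have hpi := Real.pi_pos
  have hpi' : (Real.pi : ℂ) ≠ 0 := by exact_mod_cast hpi.ne'
  set X : ℂ → ℂ := fun w => (Real.pi : ℂ) ^ 2 / 2 * (w - 1) with hX
  -- The radius 1/2 is exactly what |y| < π/2 requires when y² = (π²/2)(w - 1); then Re cosh y > 0,
  -- so (cosh y - 1)/(cosh y + 1) lies in the unit disk.
  have hroot : ∀ w ∈ ball (1 : ℂ) (1 - 1 / 2), ∃ y : ℂ, y ^ 2 = X w ∧ ‖y‖ < Real.pi / 2 :=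
    fun w hw => by
      refine ⟨X w ^ (2⁻¹ : ℂ), Complex.cpow_ofNat_inv_pow _ 2, ?_⟩
      rw [mem_ball, dist_eq_norm] at hw
      rw [← sq_lt_sq₀ (norm_nonneg _) (by positivity), ← norm_pow,
        Complex.cpow_ofNat_inv_pow _ 2, hX, norm_mul, norm_div, norm_pow,
        Complex.norm_of_nonneg hpi.le, Complex.norm_ofNat]
      nlinarith [pow_pos hpi 2]
  have hre : ∀ w ∈ ball (1 : ℂ) (1 - 1 / 2), 0 < (coshSqrt (X w)).re := fun w hw => by
    obtain ⟨y, hy, hyn⟩ := hroot w hw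
    rw [coshSqrt_eq_of_sq_eq hy]; exact cosh_re_pos hyn
  have hne : ∀ w ∈ ball (1 : ℂ) (1 - 1 / 2), coshSqrt (X w) + 1 ≠ 0 := fun w hw h => by
    have := hre w hw
    rw [eq_neg_of_add_eq_zero_left h] at this
    norm_num at this
  have hd : Differentiable ℂ fun w => coshSqrt (X w) :=
    differentiable_coshSqrt.comp (by fun_prop)
  refine subordinatesDisk_of_rightInverse
    (g := fun w => (coshSqrt (X w) - 1) / (coshSqrt (X w) + 1))
    ((hd.sub_const 1).differentiableOn.div (hd.add_const 1).differentiableOn hne)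
    (fun w hw => ?_) ?_ fun w hw => ?_
  · have := norm_sub_lt_norm_add_conj (v := 1) (hre w hw) (by simp)
    rw [map_one] at this
    rw [mem_ball_zero_iff, norm_div, div_lt_one (norm_pos_iff.mpr (hne w hw))]
    exact this
  · have : coshSqrt (X 1) = 1 := by
      rw [coshSqrt_eq_of_sq_eq (y := 0) (by simp [hX]), Complex.cosh_zero]
    simp [this]
  · obtain ⟨y, hy, hyn⟩ := hroot w hw
    simp only [coshSqrt_eq_of_sq_eq hy]
    rw [phiP_tanh_sq hyn, hy, hX]
    field_simp
    ring

theorem phiP_ne {ω : ℂ} (hω : ω ∈ ball (0 : ℂ) 1) : phiP ω ≠ ((1 / 2 : ℝ) : ℂ) := by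
  intro h
  have hpi := Real.pi_pos
  have hpi' : (Real.pi : ℂ) ≠ 0 := by exact_mod_cast hpi.ne'
  rw [mem_ball_zero_iff] at hω
  rw [phiP, one_div] at h
  set t := ω ^ (2⁻¹ : ℂ) with ht
  have ht2 : t ^ 2 = ω := Complex.cpow_ofNat_inv_pow _ 2
  have htn : ‖t‖ < 1 := by
    rw [← ht2, norm_pow] at hω
    exact lt_of_pow_lt_pow_left₀ 2 zero_le_one (by simpa using hω)
  -- The value 1/2 would force the logarithm to be ±iπ/2, but (1 + t)/(1 - t) lies in the open right
  -- half-plane.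
  have harg := Complex.abs_arg_lt_pi_div_two_iff.mpr (Or.inl (cayley_re_pos htn))
  rw [← Complex.log_im] at harg
  set l := Complex.log ((1 + t) / (1 - t))
  have hl : l ^ 2 = (Real.pi / 2 * Complex.I) ^ 2 := by
    push_cast at h
    field_simp at h
    rw [mul_pow, Complex.I_sq]
    linear_combination (1 / 4 : ℂ) * h
  have him : |l.im| = Real.pi / 2 := by
    rcases sq_eq_sq_iff_eq_or_eq_neg.mp hl with h1 | h1 <;> rw [h1] <;>
      simp [abs_of_pos (half_pos hpi)]
  rw [him] at harg
  exact lt_irrefl _ harg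

end

/-! ### Assembly and numerical values -/

theorem theorem3 :
    -- starlikeness of order `α`
    (∀ α : ℝ, 0 ≤ α → α < 1 →
      ∃ R : ℝ, IsSharpRadius (StarlikeOfOrder α) F3 f3 R ∧
        IsLeast {r : ℝ | 0 < r ∧
          (2 - α) * r ^ 3 + 2 * α * r ^ 2 + (α - 6) * r + 2 - 2 * α = 0} R) ∧
    -- lemniscate starlikeness
    (∃ R : ℝ, IsSharpRadius (StarlikeSubord phiL) F3 f3 R ∧
        IsLeast {r : ℝ | 0 < r ∧
          (Real.sqrt 2 - 2) * r ^ 3 + 2 * Real.sqrt 2 * r ^ 2 + (6 - Real.sqrt 2) * r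
            + 2 - 2 * Real.sqrt 2 = 0} R ∧
        |R - 0.1645| < 0.00005) ∧
    -- parabolic starlikeness
    (∃ R : ℝ, IsSharpRadius (StarlikeSubord phiP) F3 f3 R ∧
        IsRadius (StarlikeOfOrder (1 / 2)) F3 R ∧ |R - 0.19028| < 0.000005) ∧
    -- exponential starlikeness
    (∃ R : ℝ, IsSharpRadius (StarlikeSubord phiE) F3 f3 R ∧
        IsRadius (StarlikeOfOrder (1 / Real.exp 1)) F3 R ∧ |R - 0.2355| < 0.00005) ∧
    -- sine starlikeness
    (∃ R : ℝ, IsSharpRadius (StarlikeSubord phiSin) F3 f3 R ∧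
        IsRadius (StarlikeOfOrder (1 - Real.sin 1)) F3 R ∧ |R - 0.3017| < 0.00005) ∧
    -- lune starlikeness
    (∃ R : ℝ, IsSharpRadius (StarlikeSubord phiLune) F3 f3 R ∧
        IsRadius (StarlikeOfOrder (Real.sqrt 2 - 1)) F3 R ∧ |R - 0.2199| < 0.00005) ∧
    -- starlikeness associated with the rational function
    (∃ R : ℝ, IsSharpRadius (StarlikeSubord phiR) F3 f3 R ∧
        IsRadius (StarlikeOfOrder (2 * (Real.sqrt 2 - 1))) F3 R ∧ |R - 0.0679| < 0.00005) ∧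
    -- cardioid starlikeness
    (∃ R : ℝ, IsSharpRadius (StarlikeSubord phiC) F3 f3 R ∧
        IsRadius (StarlikeOfOrder (1 / 3)) F3 R ∧ |R - 0.2469| < 0.00005) := by
  have hs1 := sqrt_two_gt
  have hs2 := sqrt_two_lt
  refine ⟨fun α h0 h1 => exists_starlike_radius h0 h1, exists_lemniscate_radius, ?_, ?_, ?_, ?_,
    ?_, ?_⟩
  · refine exists_radius_of_subordinatesDisk (by norm_num) (by norm_num) subordinatesDisk_phiP
      (fun _ => phiP_ne) (by norm_num) (by norm_num) (by norm_num) ?_ ?_ <;>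
    norm_num [extremalQuotient]
  · have he1 : 0.36787 < 1 / Real.exp 1 := by
      rw [lt_div_iff₀ (Real.exp_pos 1)]; linarith [Real.exp_one_lt_d9]
    have he2 : 1 / Real.exp 1 < 0.36789 := by
      rw [div_lt_iff₀ (Real.exp_pos 1)]; linarith [Real.exp_one_gt_d9]
    refine exists_radius_of_subordinatesDisk (by linarith) (by linarith) subordinatesDisk_phiE
      (fun _ => phiE_ne) (by norm_num) (by norm_num) (by norm_num) (lt_trans ?_ he1)
      (he2.trans ?_) <;>
    norm_num [extremalQuotient]
  · obtain ⟨h1, h2⟩ := sin_one_bounds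
    refine exists_radius_of_subordinatesDisk (by linarith) (by linarith)
      (by rw [sub_sub_cancel]; exact subordinatesDisk_phiSin)
      (fun _ => phiSin_ne) (by norm_num) (by norm_num) (by norm_num)
      (lt_trans ?_ (sub_lt_sub_left h2 1)) ((sub_lt_sub_left h1 1).trans ?_) <;>
    norm_num [extremalQuotient]
  · refine exists_radius_of_subordinatesDisk (by linarith) (by linarith) subordinatesDisk_phiLune
      (fun _ => phiLune_ne) (by norm_num) (by norm_num) (by norm_num)
      (lt_trans ?_ (sub_lt_sub_right hs1 1)) ((sub_lt_sub_right hs2 1).trans ?_) <;>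
    norm_num [extremalQuotient]
  · refine exists_radius_of_subordinatesDisk (by linarith) (by linarith) subordinatesDisk_phiR
      (fun _ => phiR_ne) (by norm_num) (by norm_num) (by norm_num)
      (lt_trans ?_ (mul_lt_mul_of_pos_left (sub_lt_sub_right hs1 1) two_pos))
      ((mul_lt_mul_of_pos_left (sub_lt_sub_right hs2 1) two_pos).trans ?_) <;>
    norm_num [extremalQuotient]
  · refine exists_radius_of_subordinatesDisk (by norm_num) (by norm_num) subordinatesDisk_phiC
      (fun _ => phiC_ne) (by norm_num) (by norm_num) (by norm_num) ?_ ?_ <;>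
    norm_num [extremalQuotient]
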